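/- **Setting.** Let $\mathsf X,\mathsf Y,\mathsf E$ be measurable spaces, $\mathsf X\neq\emptyset$, $\mu,\eta$ measures on $\mathsf X,\mathsf Y$, $\nu$ a probability measure on $\mathsf E$, $\Theta=\mathbb R^d$ and $N\ge 1$. Let $\bar m(x,x')$, $\bar g(x,y)$ be the transition and emission densities (w.r.t. $\mu$ and $\eta$) of the state-space model that generates the data. For $\theta\in\Theta$ let $m_\theta(x,x')$, $g_\theta(x,y)$ be the state and emission densities of the fitted model, $r_\theta(x,x',y)$ a proposal density (w.r.t. $\mu$, in $x'$), and $F_\theta:\mathsf X\times\mathsf Y\times\mathsf E\to\mathsf X$ a function such that $F_\theta(x,y,\cdot)$ maps $\nu$ to $r_\theta(x,x',y)\,\mu(dx')$. All these functions are measurable for fixed $\theta$. Put $w_\theta(x,x',y)=m_\theta(x,x')g_\theta(x',y)/r_\theta(x,x',y)$. For $z=(x,y,\tilde x^{1:N},v^{1:N})\in\mathsf Z=\mathsf X\times\mathsf Y\times\mathsf X^N\times\mathsf E^N$, let $T_\theta(z,\cdot)$ be the law of $(X',Y',\tilde X'^{1:N},V'^{1:N})$ where $(X',Y')\sim \bar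 m(x,x')\bar g(x',y')\,\mu(dx')\eta(dy')$, $V'^{1:N}\sim\nu^{\otimes N}$, and $\tilde X'^{j}=\xi^{I^j}$ with $\xi^k\sim r_\theta(\tilde x^k,\cdot,y)\,d\mu$ independent and $I^1,\dots,I^N$ i.i.d. given $\xi^{1:N}$ with $\mathbb P(I^j=i)\propto w_\theta(\tilde x^i,\xi^i,y)$; the three groups $(X',Y')$, $\tilde X'^{1:N}$, $V'^{1:N}$ are independent. Define $$H_\theta(z)=\nabla_\theta\log\sum_{i=1}^N w_\theta\big(\tilde x^i,F_\theta(\tilde x^i,y,v^i),y\big),\qquad h(\theta)=\int H_\theta(z)\,\pi_\theta(dz),$$ where $\pi_\theta$ is the stationary distribution of $T_\theta$. Given $\theta_0\in\Theta$, $u\in\mathsf X$, a probability measure $\chi$ on $\mathsf X$ and step sizes $(\gamma_t)_{t\ge1}$, let $Z_0\sim \chi(dx)\,\bar g(x,y)\eta(dy)\,\delta_u^{\otimes N}\,\nu^{\otimes N}$ and, for $t\ge0$, $Z_{t+1}\sim T_{\theta_t}(Z_t,\cdot)$ conditionally on $Z_0,\dots,Z_t$, and $\theta_{t+1}=\theta_t+\gamma_{t+1}H_{\theta_t}(Z_{t+1})$.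 **Assumptions.** 1. There is $\epsilon\in(0,1)$ such that $\bar m,m_\theta,g_\theta,r_\theta$ take values in $[\epsilon,1/\epsilon]$ for all arguments and all $\theta$. 2. The functions $\theta\mapsto m_\theta(x,F_\theta(x,y,v))$, $g_\theta(F_\theta(x,y,v),y)$, $r_\theta(x,F_\theta(x,y,v),y)$ are differentiable, and there is $\kappa\ge 1$, not depending on $x,x',y,v$, such that their gradients are bounded by $\kappa$ and these functions, their gradients, and $\theta\mapsto m_\theta(x,x'),\ g_\theta(x,y),\ r_\theta(x,x',y)$ are $\kappa$-Lipschitz. 3. There is a bounded function $V:\Theta\to\mathbb R$ with $\nabla V=h$. **Corollary 4.8.** Under these assumptions, for every $\theta$ the kernel $T_\theta$ has exactly one stationary distribution $\pi_\theta$ and $H_\theta$ is $\pi_\theta$-integrable. Moreover, for every $c>0$, with the step sizes $\gamma_t=c/\sqrt t$, $t\ge1$, $$\mathbb E\big[\|h(\theta_\tau)\|^2\big]=\mathcal O\!\left(\frac{\log t}{\sqrt t}\right),$$ where $\tau$ is independent of $(Z_s)_{s\ge0}$ with $\mathbb P(\tau=s)=\gamma_{s+1}/\sum_{k=0}^t\gamma_{k+1}$,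 $0\le s\le t$; that is, there is a constant $C$, not depending on $t$, $\theta_0$, $\chi$ or $u$, such that $\mathbb E[\|h(\theta_\tau)\|^2]\le C\log t/\sqrt t$ for all $t\ge2$. -/

import Mathlib

open MeasureTheory ProbabilityTheory Filter

noncomputable section

namespace OVSMC

/-- The parameter space: vectors `θ ∈ ℝ^d` with the Euclidean norm. -/
abbrev Param (d : ℕ) : Type := EuclideanSpace ℝ (Fin d)

/-- The data entering the online variational SMC recursion: reference measures `μ` on the state
space and `η` on the observation space, noise distribution `ν`, the densities `mbar`, `gbar` of the
state-space model that generates the data, and, for each parameter `θ`, the transition density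
`m θ x x'`, the emission density `g θ x y`, the proposal density `r θ x x' y` (a density in `x'`)
and the reparameterization function `F θ x y v`. Their standing properties are in
`Model.Regular`. -/
structure Model (d : ℕ) (X Y E : Type*) [MeasurableSpace X] [MeasurableSpace Y]
    [MeasurableSpace E] where
  μ : Measure X
  η : Measure Y
  ν : Measure E
  mbar : X → X → ℝ
  gbar : X → Y → ℝ
  m : Param d → X → X → ℝ
  g : Param d → X → Y → ℝ
  r : Param d → X → X → Y → ℝ
  F : Param d → X → Y → E → X

/-- The state space of the extended chain `Z_t = ((X_t, Y_t), resampled particles, noise)`,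
with `N` particles. -/
abbrev State (N : ℕ) (X Y E : Type*) : Type _ := (X × Y) × (Fin N → X) × (Fin N → E)

namespace Model

variable {d : ℕ} {X Y E : Type*} [MeasurableSpace X] [MeasurableSpace Y] [MeasurableSpace E]

/-- The functions are measurable, `ν` is a probability measure, the densities are nonnegative and
normalized, and `F θ x y` pushes `ν` forward to the proposal distribution. -/
structure Regular (S : Model d X Y E) : Prop where
  prob_ν : IsProbabilityMeasure S.ν
  measurable_mbar : Measurable fun p : X × X => S.mbar p.1 p.2
  measurable_gbar : Measurable fun p : X × Y => S.gbar p.1 p.2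
  measurable_m : ∀ θ, Measurable fun p : X × X => S.m θ p.1 p.2
  measurable_g : ∀ θ, Measurable fun p : X × Y => S.g θ p.1 p.2
  measurable_r : ∀ θ, Measurable fun p : X × X × Y => S.r θ p.1 p.2.1 p.2.2
  measurable_F : ∀ θ, Measurable fun p : X × Y × E => S.F θ p.1 p.2.1 p.2.2
  mbar_nonneg : ∀ x x', 0 ≤ S.mbar x x'
  gbar_nonneg : ∀ x y, 0 ≤ S.gbar x y
  m_nonneg : ∀ θ x x', 0 ≤ S.m θ x x'
  g_nonneg : ∀ θ x y, 0 ≤ S.g θ x y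
  r_nonneg : ∀ θ x x' y, 0 ≤ S.r θ x x' y
  lintegral_mbar : ∀ x, ∫⁻ x', ENNReal.ofReal (S.mbar x x') ∂S.μ = 1
  lintegral_gbar : ∀ x, ∫⁻ y, ENNReal.ofReal (S.gbar x y) ∂S.η = 1
  lintegral_m : ∀ θ x, ∫⁻ x', ENNReal.ofReal (S.m θ x x') ∂S.μ = 1
  lintegral_g : ∀ θ x, ∫⁻ y, ENNReal.ofReal (S.g θ x y) ∂S.η = 1
  lintegral_r : ∀ θ x y, ∫⁻ x', ENNReal.ofReal (S.r θ x x' y) ∂S.μ = 1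
  map_F : ∀ θ x y,
    S.ν.map (S.F θ x y) = S.μ.withDensity fun x' => ENNReal.ofReal (S.r θ x x' y)

/-- Strong mixing: `mbar`, `m`, `g`, `r` are bounded above and below, uniformly in all arguments
and in the parameter. -/
def StrongMixing (S : Model d X Y E) : Prop :=
  ∃ ε : ℝ, 0 < ε ∧ ε < 1 ∧ ∀ (θ : Param d) (x x' : X) (y : Y),
    (ε ≤ S.mbar x x' ∧ S.mbar x x' ≤ 1 / ε) ∧
    (ε ≤ S.m θ x x' ∧ S.m θ x x' ≤ 1 / ε) ∧
    (ε ≤ S.g θ x y ∧ S.g θ x y ≤ 1 / ε) ∧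
    (ε ≤ S.r θ x x' y ∧ S.r θ x x' y ≤ 1 / ε)

/-- The function `θ ↦ m_θ(x, F_θ(x, y, v))`. -/
def mF (S : Model d X Y E) (x : X) (y : Y) (v : E) (θ : Param d) : ℝ := S.m θ x (S.F θ x y v)

/-- The function `θ ↦ g_θ(F_θ(x, y, v), y)`. -/
def gF (S : Model d X Y E) (x : X) (y : Y) (v : E) (θ : Param d) : ℝ := S.g θ (S.F θ x y v) y

/-- The function `θ ↦ r_θ(x, F_θ(x, y, v), y)`. -/
def rF (S : Model d X Y E) (x : X) (y : Y) (v : E) (θ : Param d) : ℝ := S.r θ x (S.F θ x y v) y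

/-- The densities, their compositions with the reparameterization function and the gradients (in
`θ`) of these compositions are Lipschitz in `θ`, and the gradients are bounded, uniformly in all
the other arguments. -/
def LipschitzGradients (S : Model d X Y E) : Prop :=
  (∀ x y v, Differentiable ℝ (S.mF x y v) ∧ Differentiable ℝ (S.gF x y v) ∧
    Differentiable ℝ (S.rF x y v)) ∧
  ∃ κ : ℝ, 1 ≤ κ ∧ ∀ (θ θ' : Param d) (x x' : X) (y : Y) (v : E),
    (‖gradient (S.mF x y v) θ‖ ≤ κ ∧ ‖gradient (S.gF x y v) θ‖ ≤ κ ∧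
      ‖gradient (S.rF x y v) θ‖ ≤ κ) ∧
    (|S.m θ x x' - S.m θ' x x'| ≤ κ * ‖θ - θ'‖ ∧
      |S.mF x y v θ - S.mF x y v θ'| ≤ κ * ‖θ - θ'‖ ∧
      ‖gradient (S.mF x y v) θ - gradient (S.mF x y v) θ'‖ ≤ κ * ‖θ - θ'‖) ∧
    (|S.g θ x y - S.g θ' x y| ≤ κ * ‖θ - θ'‖ ∧
      |S.gF x y v θ - S.gF x y v θ'| ≤ κ * ‖θ - θ'‖ ∧
      ‖gradient (S.gF x y v) θ - gradient (S.gF x y v) θ'‖ ≤ κ * ‖θ - θ'‖) ∧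
    (|S.r θ x x' y - S.r θ' x x' y| ≤ κ * ‖θ - θ'‖ ∧
      |S.rF x y v θ - S.rF x y v θ'| ≤ κ * ‖θ - θ'‖ ∧
      ‖gradient (S.rF x y v) θ - gradient (S.rF x y v) θ'‖ ≤ κ * ‖θ - θ'‖)

/-- The importance weight `w_θ(x, x', y) = m_θ(x, x') g_θ(x', y) / r_θ(x, x', y)`. -/
def weight (S : Model d X Y E) (θ : Param d) (x x' : X) (y : Y) : ℝ :=
  S.m θ x x' * S.g θ x' y / S.r θ x x' y

/-- The probability `w_i / ∑_ℓ w_ℓ` of selecting particle `i` in the resampling step, when `ξ` has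
been proposed from the resampled particles `xt` at observation `y`. -/
def selectProb (S : Model d X Y E) {N : ℕ} (θ : Param d) (xt ξ : Fin N → X) (y : Y)
    (i : Fin N) : ℝ :=
  S.weight θ (xt i) (ξ i) y / ∑ l, S.weight θ (xt l) (ξ l) y

/-- Law of the resampled particles: propose `ξ^k ∼ r_θ(xt^k, ·, y) dμ` independently, draw ancestor
indices `I^1, …, I^N` independently from the categorical distribution of the weights, and return
`ξ^{I^1}, …, ξ^{I^N}`. -/
def particleLaw (S : Model d X Y E) {N : ℕ} (θ : Param d) (xt : Fin N → X) (y : Y) :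
    Measure (Fin N → X) :=
  (Measure.pi fun k => S.μ.withDensity fun x' => ENNReal.ofReal (S.r θ (xt k) x' y)).bind
    fun ξ => ∑ I : Fin N → Fin N,
      (∏ j, ENNReal.ofReal (S.selectProb θ xt ξ y (I j))) • Measure.dirac fun j => ξ (I j)

/-- The transition kernel `T_θ(z, ·)` of the extended chain. -/
def trans (S : Model d X Y E) (N : ℕ) (θ : Param d) (z : State N X Y E) :
    Measure (State N X Y E) :=
  ((S.μ.prod S.η).withDensity
      fun p => ENNReal.ofReal (S.mbar z.1.1 p.1) * ENNReal.ofReal (S.gbar p.1 p.2)).prod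
    ((S.particleLaw θ z.2.1 z.1.2).prod (Measure.pi fun _ => S.ν))

/-- The law of `Z_0`: `X_0 ∼ χ`, `Y_0 ∼ gbar(X_0, ·) dη`, all dummy particles at `u`, and
independent noise. -/
def initLaw (S : Model d X Y E) (N : ℕ) (χ : Measure X) (u : X) : Measure (State N X Y E) :=
  ((χ.prod S.η).withDensity fun p => ENNReal.ofReal (S.gbar p.1 p.2)).prod
    ((Measure.dirac fun _ => u).prod (Measure.pi fun _ => S.ν))

/-- `π` is a stationary probability distribution of the kernel `T_θ`. -/
def IsStationary (S : Model d X Y E) (N : ℕ) (θ : Param d) (π : Measure (State N X Y E)) : Prop :=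
  IsProbabilityMeasure π ∧ ∀ A, MeasurableSet A → ∫⁻ z, S.trans N θ z A ∂π = π A

open Classical in
/-- The stationary distribution `π_θ` of `T_θ` (the zero measure if there is none). -/
def statDist (S : Model d X Y E) (N : ℕ) (θ : Param d) : Measure (State N X Y E) :=
  if h : ∃ π, S.IsStationary N θ π then h.choose else 0

/-- The gradient estimate `H_θ(z) = ∇_θ log ∑_i w_θ(xt^i, F_θ(xt^i, y, v^i), y)`. -/
def gradEst (S : Model d X Y E) (N : ℕ) (θ : Param d) (z : State N X Y E) : Param d :=
  gradient (fun θ' : Param d => Real.log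
    (∑ i, S.weight θ' (z.2.1 i) (S.F θ' (z.2.1 i) z.1.2 (z.2.2 i)) z.1.2)) θ

/-- The mean field `h(θ) = ∫ H_θ(z) π_θ(dz)`. -/
def meanField (S : Model d X Y E) (N : ℕ) (θ : Param d) : Param d :=
  ∫ z, S.gradEst N θ z ∂S.statDist N θ

/-- The stochastic approximation recursion `θ_{t+1} = θ_t + γ_{t+1} H_{θ_t}(Z_{t+1})` along a
trajectory `Z`. -/
def iter (S : Model d X Y E) (N : ℕ) (γ : ℕ → ℝ) (θ₀ : Param d) (Z : ℕ → State N X Y E) :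
    ℕ → Param d
  | 0 => θ₀
  | t + 1 => iter S N γ θ₀ Z t + γ (t + 1) • S.gradEst N (iter S N γ θ₀ Z t) (Z (t + 1))

/-- The σ-algebra `𝓕_t` generated by `Z_0, …, Z_t`. -/
abbrev past {N : ℕ} {Ω : Type*} (Z : ℕ → Ω → State N X Y E) (t : ℕ) : MeasurableSpace Ω :=
  ⨆ (s : ℕ) (_ : s ≤ t), (inferInstance : MeasurableSpace (State N X Y E)).comap (Z s)

/-- `Z` is the state-dependent Markov chain driving the algorithm: it starts from the initial law,
and given `𝓕_t` the next state `Z_{t+1}` has distribution `T_{θ_t}(Z_t, ·)`. -/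
structure IsChain (S : Model d X Y E) (N : ℕ) (γ : ℕ → ℝ) (θ₀ : Param d) (χ : Measure X) (u : X)
    {Ω : Type*} [MeasurableSpace Ω] (P : Measure Ω) (Z : ℕ → Ω → State N X Y E) : Prop where
  measurable : ∀ t, Measurable (Z t)
  map_zero : P.map (Z 0) = S.initLaw N χ u
  step : ∀ (t : ℕ) (f : State N X Y E → ℝ), Measurable f → (∃ B, ∀ z, |f z| ≤ B) →
    P[fun ω => f (Z (t + 1) ω) | past Z t] =ᵐ[P]
      fun ω => ∫ z, f z ∂S.trans N (S.iter N γ θ₀ (fun s => Z s ω) t) (Z t ω)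

end Model

/-- The step sizes `γ_t = c / √t`, `t ≥ 1`. -/
def stepSize (c : ℝ) (t : ℕ) : ℝ := c / Real.sqrt t

/-- `τ` has the categorical distribution on `{0, …, t}` with weights `γ_1, …, γ_{t+1}`. -/
def IsCat (γ : ℕ → ℝ) (t : ℕ) {Ω : Type*} [MeasurableSpace Ω] (P : Measure Ω) (τ : Ω → ℕ) : Prop :=
  Measurable τ ∧ (∀ᵐ ω ∂P, τ ω ≤ t) ∧
    ∀ s ≤ t, P.real (τ ⁻¹' {s}) = γ (s + 1) / ∑ k ∈ Finset.range (t + 1), γ (k + 1)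

end OVSMC

end

noncomputable section

namespace OVSMC

/-! The argument is stochastic approximation with Markovian noise, with the noise removed by a
Poisson equation whose solution is Lipschitz in the parameter.

Mixing and minorization. Record the proposals and the ancestor indices as part of the draw. Then
`T_θ` is the image, under a fixed map, of a law with density at least `δ > 0` with respect to a
finite measure `B` free of `θ` and of the current state (`trans_eq_densKernel`, `minorizedFamily`).
So `T_θ` splits as `R_θ + ρ₀`, with `ρ₀` a fixed measure of mass `b = δ B(univ)` and `R_θ` of mass
`1 - b`. Summing `ρ₀ R_θ^n` gives a stationary law, and `G_θ = ∑ R_θ^n H_θ` converges geometrically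
and solves `T_θ G_θ = G_θ - H_θ + h(θ)` (`poisson_sub_integral`, `integral_stationary`). Since the
density and `H_θ` are bounded and Lipschitz in `θ`, so are `G_θ` (`poisson_lip`) and `h`.

Drift. As `∇V = h` is Lipschitz, `V(θ_{s+1}) - V(θ_s)` is at least `γ ⟨h, H⟩ - O(γ²)`. With `A = ⟨h,
G⟩` and `Ψ = ⟨h, T G⟩ = ⟨h, G - H + h⟩` one has `⟨h, H⟩ = ‖h‖² + A - Ψ`. By the Markov property
`A(θ_s, Z_{s+1})` has the mean of `Ψ(θ_s, Z_s)`, and moving from `θ_s` to `θ_{s+1}` inside `Ψ` costs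
`O(γ)`. So the noise term is `γ` times an increment of a bounded sequence, and Abel summation with
decreasing steps bounds its sum (`sum_le_of_drift`). What remains is `∑ γ² = O(log t)`, divided by
`∑ γ ≥ c √t`. -/

/-! ### Calculus of uniformly bounded, Lipschitz and smooth families. -/

/-- The family `f a`, `a : α`, is bounded and Lipschitz, uniformly in `a`. -/
def UnifLip {α Θ F : Type*} [NormedAddCommGroup Θ] [NormedAddCommGroup F] (f : α → Θ → F) : Prop :=
  ∃ K : ℝ, 0 ≤ K ∧ ∀ a θ θ', ‖f a θ‖ ≤ K ∧ ‖f a θ - f a θ'‖ ≤ K * ‖θ - θ'‖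

namespace UnifLip

variable {α β Θ F G : Type*} [NormedAddCommGroup Θ] [NormedAddCommGroup F]
  [NormedAddCommGroup G]

lemma comp_index {f : α → Θ → F} (hf : UnifLip f) (e : β → α) : UnifLip fun b => f (e b) := by
  obtain ⟨K, hK, h⟩ := hf
  exact ⟨K, hK, fun a => h (e a)⟩

lemma continuous {f : α → Θ → F} (hf : UnifLip f) (a : α) : Continuous (f a) := by
  obtain ⟨K, hK, h⟩ := hf
  refine (LipschitzWith.of_dist_le_mul (K := ⟨K, hK⟩) fun θ θ' => ?_).continuous
  rw [dist_eq_norm, dist_eq_norm]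
  exact (h a θ θ').2

lemma const {f : α → F} (hf : ∃ K, ∀ a, ‖f a‖ ≤ K) : UnifLip fun a (_ : Θ) => f a := by
  obtain ⟨K, hK⟩ := hf
  -- The absolute value is needed because `K` may be negative when `α` is empty.
  refine ⟨|K|, abs_nonneg K, fun a θ θ' => ⟨(hK a).trans (le_abs_self K), ?_⟩⟩
  simp only [sub_self, norm_zero]
  positivity

lemma add {f g : α → Θ → F} (hf : UnifLip f) (hg : UnifLip g) :
    UnifLip fun a θ => f a θ + g a θ := by
  obtain ⟨K, hK, h⟩ := hf
  obtain ⟨L, hL, h'⟩ := hg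
  refine ⟨K + L, by positivity, fun a θ θ' => ⟨?_, ?_⟩⟩
  · exact (norm_add_le _ _).trans (add_le_add (h a θ θ').1 (h' a θ θ').1)
  · rw [add_sub_add_comm, add_mul]
    exact (norm_add_le _ _).trans (add_le_add (h a θ θ').2 (h' a θ θ').2)

lemma neg {f : α → Θ → F} (hf : UnifLip f) : UnifLip fun a θ => -f a θ := by
  obtain ⟨K, hK, h⟩ := hf
  refine ⟨K, hK, fun a θ θ' => ⟨by rw [norm_neg]; exact (h a θ θ').1, ?_⟩⟩
  rw [neg_sub_neg, norm_sub_rev]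
  exact (h a θ θ').2

lemma sub {f g : α → Θ → F} (hf : UnifLip f) (hg : UnifLip g) :
    UnifLip fun a θ => f a θ - g a θ := by
  simpa only [sub_eq_add_neg] using hf.add hg.neg

lemma zero : UnifLip fun (_ : α) (_ : Θ) => (0 : F) :=
  ⟨0, le_rfl, fun _ _ _ => by simp⟩

lemma sum {ι : Type*} (s : Finset ι) {f : ι → α → Θ → F} (hf : ∀ i, UnifLip (f i)) :
    UnifLip fun a θ => ∑ i ∈ s, f i a θ := by
  classical
  induction s using Finset.induction_on with
  | empty => simpa using zero
  | insert i s hi ih => simpa [Finset.sum_insert hi] using (hf i).add ih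

/-- A bilinear operation of norm at most one preserves uniform Lipschitz bounds. -/
lemma bilin {H : Type*} [NormedAddCommGroup H] {B : F → G → H}
    (hB : ∀ x y, ‖B x y‖ ≤ ‖x‖ * ‖y‖) (hB₁ : ∀ x x' y, B x y - B x' y = B (x - x') y)
    (hB₂ : ∀ x y y', B x y - B x y' = B x (y - y'))
    {f : α → Θ → F} {g : α → Θ → G} (hf : UnifLip f) (hg : UnifLip g) :
    UnifLip fun a θ => B (f a θ) (g a θ) := by
  obtain ⟨K, hK, h⟩ := hf
  obtain ⟨L, hL, h'⟩ := hg
  refine ⟨2 * (K * L), by positivity, fun a θ θ' => ⟨?_, ?_⟩⟩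
  · calc _ ≤ ‖f a θ‖ * ‖g a θ‖ := hB _ _
      _ ≤ K * L := mul_le_mul (h a θ θ').1 (h' a θ θ').1 (norm_nonneg _) hK
      _ ≤ _ := by nlinarith [mul_nonneg hK hL]
  · calc _ = ‖B (f a θ - f a θ') (g a θ) + B (f a θ') (g a θ - g a θ')‖ := by
          rw [← hB₁, ← hB₂, sub_add_sub_cancel]
      _ ≤ ‖f a θ - f a θ'‖ * ‖g a θ‖ + ‖f a θ'‖ * ‖g a θ - g a θ'‖ :=
          (norm_add_le _ _).trans (add_le_add (hB _ _) (hB _ _))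
      _ ≤ (K * ‖θ - θ'‖) * L + K * (L * ‖θ - θ'‖) :=
          add_le_add (mul_le_mul (h a θ θ').2 (h' a θ θ').1 (norm_nonneg _) (by positivity))
            (mul_le_mul (h a θ' θ).1 (h' a θ θ').2 (norm_nonneg _) hK)
      _ = _ := by ring

lemma smul [NormedSpace ℝ F] {f : α → Θ → ℝ} {g : α → Θ → F} (hf : UnifLip f) (hg : UnifLip g) :
    UnifLip fun a θ => f a θ • g a θ :=
  bilin (fun x y => (norm_smul x y).le) (fun x x' y => (sub_smul x x' y).symm)
    (fun x y y' => (smul_sub x y y').symm) hf hg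

lemma mul {f g : α → Θ → ℝ} (hf : UnifLip f) (hg : UnifLip g) :
    UnifLip fun a θ => f a θ * g a θ := hf.smul hg

lemma inner [InnerProductSpace ℝ F] {f g : α → Θ → F} (hf : UnifLip f) (hg : UnifLip g) :
    UnifLip fun a θ => inner ℝ (f a θ) (g a θ) :=
  bilin (norm_inner_le_norm (𝕜 := ℝ)) (fun x x' y => (inner_sub_left x x' y).symm)
    (fun x y y' => (inner_sub_right x y y').symm) hf hg

lemma prod {ι : Type*} (s : Finset ι) {f : ι → α → Θ → ℝ} (hf : ∀ i, UnifLip (f i)) :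
    UnifLip fun a θ => ∏ i ∈ s, f i a θ := by
  classical
  induction s using Finset.induction_on with
  | empty => simpa using const (f := fun _ : α => (1 : ℝ)) ⟨1, by simp⟩
  | insert i s hi ih => simpa [Finset.prod_insert hi] using (hf i).mul ih

lemma inv {f : α → Θ → ℝ} (hf : UnifLip f) {ε : ℝ} (hε : 0 < ε) (h0 : ∀ a θ, ε ≤ f a θ) :
    UnifLip fun a θ => (f a θ)⁻¹ := by
  obtain ⟨K, hK, h⟩ := hf
  have hpos : ∀ a θ, 0 < f a θ := fun a θ => hε.trans_le (h0 a θ)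
  have hinv : ∀ a θ, (f a θ)⁻¹ ≤ ε⁻¹ := fun a θ => inv_anti₀ hε (h0 a θ)
  have hinv' : ∀ a θ, 0 ≤ (f a θ)⁻¹ := fun a θ => (inv_pos.2 (hpos a θ)).le
  -- The first summand bounds the inverse. The second is its Lipschitz constant, from `1/a - 1/b =
  -- (1/a)(b - a)(1/b)`.
  refine ⟨ε⁻¹ + ε⁻¹ * (K * ε⁻¹), by positivity, fun a θ θ' => ⟨?_, ?_⟩⟩
  · rw [Real.norm_of_nonneg (hinv' a θ)]
    have : 0 ≤ ε⁻¹ * (K * ε⁻¹) := by positivity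
    linarith [hinv a θ]
  · have e : (f a θ)⁻¹ - (f a θ')⁻¹ = (f a θ)⁻¹ * ((f a θ' - f a θ) * (f a θ')⁻¹) := by
      have := (hpos a θ).ne'
      have := (hpos a θ').ne'
      field_simp
    rw [e, norm_mul, norm_mul, Real.norm_of_nonneg (hinv' a θ), Real.norm_of_nonneg (hinv' a θ'),
      norm_sub_rev]
    calc _ ≤ ε⁻¹ * (K * ‖θ - θ'‖ * ε⁻¹) := by
          have := (h a θ θ').2
          have := hinv a θ
          have := hinv a θ'
          have := hinv' a θ'
          gcongr
      _ ≤ _ := by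
          have : 0 ≤ ε⁻¹ * ‖θ - θ'‖ := by positivity
          nlinarith

/-- Transfers bounds along a linear isometry; it serves to pass between Fréchet derivatives and
gradients. -/
lemma of_norm_eq {f : α → Θ → F} {g : α → Θ → G} (hf : UnifLip f)
    (h : ∀ a θ, ‖g a θ‖ = ‖f a θ‖) (h' : ∀ a θ θ', ‖g a θ - g a θ'‖ = ‖f a θ - f a θ'‖) :
    UnifLip g := by
  obtain ⟨K, hK, hf⟩ := hf
  exact ⟨K, hK, fun a θ θ' => by rw [h, h']; exact hf a θ θ'⟩

end UnifLip

/-- The functions `f a`, `a : α`, are differentiable, bounded and Lipschitz together with their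
derivatives, uniformly in `a`. -/
structure UnifSmooth {α Θ : Type*} [NormedAddCommGroup Θ] [NormedSpace ℝ Θ] (f : α → Θ → ℝ) :
    Prop where
  diff : ∀ a, Differentiable ℝ (f a)
  lip : UnifLip f
  fderiv_lip : UnifLip fun a θ => fderiv ℝ (f a) θ

namespace UnifSmooth

variable {α β Θ : Type*} [NormedAddCommGroup Θ] [NormedSpace ℝ Θ]

lemma comp_index {f : α → Θ → ℝ} (hf : UnifSmooth f) (e : β → α) :
    UnifSmooth fun b => f (e b) :=
  ⟨fun b => hf.diff (e b), hf.lip.comp_index e, hf.fderiv_lip.comp_index e⟩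

lemma mul {f g : α → Θ → ℝ} (hf : UnifSmooth f) (hg : UnifSmooth g) :
    UnifSmooth fun a θ => f a θ * g a θ where
  diff a := (hf.diff a).mul (hg.diff a)
  lip := hf.lip.mul hg.lip
  fderiv_lip := by
    have h := (hf.lip.smul hg.fderiv_lip).add (hg.lip.smul hf.fderiv_lip)
    convert h using 3 with a θ
    exact fderiv_fun_mul (hf.diff a θ) (hg.diff a θ)

lemma sum {ι : Type*} (s : Finset ι) {f : ι → α → Θ → ℝ} (hf : ∀ i, UnifSmooth (f i)) :
    UnifSmooth fun a θ => ∑ i ∈ s, f i a θ where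
  diff a := Differentiable.fun_sum fun i _ => (hf i).diff a
  lip := UnifLip.sum s fun i => (hf i).lip
  fderiv_lip := by
    have h := UnifLip.sum s fun i => (hf i).fderiv_lip
    convert h using 3 with a θ
    exact fderiv_fun_sum fun i _ => (hf i).diff a θ

lemma inv {f : α → Θ → ℝ} (hf : UnifSmooth f) {ε : ℝ} (hε : 0 < ε) (h0 : ∀ a θ, ε ≤ f a θ) :
    UnifSmooth fun a θ => (f a θ)⁻¹ where
  diff a := (hf.diff a).inv fun θ => (hε.trans_le (h0 a θ)).ne'
  lip := hf.lip.inv hε h0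
  fderiv_lip := by
    have hi := hf.lip.inv hε h0
    have h := ((hi.mul hi).neg).smul hf.fderiv_lip
    convert h using 3 with a θ
    have := (hasDerivAt_inv (hε.trans_le (h0 a θ)).ne').comp_hasFDerivAt θ
      (hf.diff a θ).hasFDerivAt
    rw [← mul_inv, ← sq]
    exact this.fderiv

/-- The derivative of the logarithm of a family that is bounded below. -/
lemma fderiv_log_lip {f : α → Θ → ℝ} (hf : UnifSmooth f) {ε : ℝ} (hε : 0 < ε)
    (h0 : ∀ a θ, ε ≤ f a θ) : UnifLip fun a θ => fderiv ℝ (fun θ => Real.log (f a θ)) θ := by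
  have h := (hf.lip.inv hε h0).smul hf.fderiv_lip
  convert h using 3 with a θ
  exact ((hf.diff a θ).hasFDerivAt.log (hε.trans_le (h0 a θ)).ne').fderiv

end UnifSmooth

/-- A function of `(θ, a)` that is Lipschitz in `θ` and measurable in `a` is jointly measurable. -/
lemma UnifLip.stronglyMeasurable_uncurry {α Θ F : Type*} [MeasurableSpace α]
    [NormedAddCommGroup Θ] [MeasurableSpace Θ] [BorelSpace Θ] [SecondCountableTopology Θ]
    [NormedAddCommGroup F] {f : Θ → α → F} (hf : UnifLip fun a θ => f θ a)
    (hm : ∀ θ, StronglyMeasurable (f θ)) : StronglyMeasurable (Function.uncurry f) :=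
  stronglyMeasurable_uncurry_of_continuous_of_stronglyMeasurable hf.continuous hm

lemma UnifLip.measurable_uncurry {α Θ : Type*} [MeasurableSpace α]
    [NormedAddCommGroup Θ] [MeasurableSpace Θ] [BorelSpace Θ] [SecondCountableTopology Θ]
    {f : Θ → α → ℝ} (hf : UnifLip fun a θ => f θ a)
    (hm : ∀ θ, Measurable (f θ)) : Measurable (Function.uncurry f) :=
  measurable_uncurry_of_continuous_of_measurable hf.continuous hm

/-! ### Minorized kernels: residual contraction and the Poisson equation. -/

/-- A family of Markov kernels on `Z`, given by densities `D θ z` with respect to a finite measure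
`B` and a map `Φ : W → Z`, where the densities are bounded, bounded below by `δ > 0` and Lipschitz
in the parameter `θ`. -/
structure MinorizedFamily {Θ Z W : Type*} [NormedAddCommGroup Θ] [MeasurableSpace Z]
    [MeasurableSpace W] (B : Measure W) (Φ : W → Z) (D : Θ → Z → W → ℝ) (δ : ℝ) : Prop where
  finite_base : IsFiniteMeasure B
  measurable_map : Measurable Φ
  measurable_dens : ∀ θ, Measurable fun p : Z × W => D θ p.1 p.2
  δ_pos : 0 < δ
  le_dens : ∀ θ z w, δ ≤ D θ z w
  dens_lip : UnifLip fun (p : Z × W) θ => D θ p.1 p.2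
  integral_dens : ∀ θ z, ∫ w, D θ z w ∂B = 1

/-- The kernels of a minorized family. -/
def densKernel {Θ Z W : Type*} [MeasurableSpace Z] [MeasurableSpace W] (B : Measure W) (Φ : W → Z)
    (D : Θ → Z → W → ℝ) (θ : Θ) (z : Z) : Measure Z :=
  (B.withDensity fun w => ENNReal.ofReal (D θ z w)).map Φ

namespace MinorizedFamily

variable {Θ Z W F : Type*} [NormedAddCommGroup Θ] [MeasurableSpace Z] [MeasurableSpace W]
  {B : Measure W} {Φ : W → Z} {D : Θ → Z → W → ℝ} {δ : ℝ}
  [NormedAddCommGroup F] [NormedSpace ℝ F]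

section basic

variable (S : MinorizedFamily B Φ D δ)
include S

lemma measurable_dens_right (θ : Θ) (z : Z) : Measurable (D θ z) :=
  (S.measurable_dens θ).comp measurable_prodMk_left

lemma dens_nonneg (θ : Θ) (z : Z) (w : W) : 0 ≤ D θ z w := S.δ_pos.le.trans (S.le_dens θ z w)

lemma integrable_dens (θ : Θ) (z : Z) : Integrable (D θ z) B := by
  -- The Bochner integral of a non-integrable function is `0`, whereas the density has integral `1`.
  by_contra h
  have := S.integral_dens θ z
  rw [integral_undef h] at this
  exact zero_ne_one this

lemma integral_densKernel (θ : Θ) (z : Z) {f : Z → F} (hf : StronglyMeasurable f) :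
    ∫ z', f z' ∂densKernel B Φ D θ z = ∫ w, D θ z w • f (Φ w) ∂B := by
  rw [densKernel, integral_map S.measurable_map.aemeasurable hf.aestronglyMeasurable,
    integral_withDensity_eq_integral_toReal_smul
      (S.measurable_dens_right θ z).ennreal_ofReal (by simp)]
  refine integral_congr_ae (Eventually.of_forall fun w => ?_)
  simp only [ENNReal.toReal_ofReal (S.dens_nonneg θ z w)]

lemma isProbabilityMeasure (θ : Θ) (z : Z) : IsProbabilityMeasure (densKernel B Φ D θ z) := by
  have : IsProbabilityMeasure (B.withDensity fun w => ENNReal.ofReal (D θ z w)) := by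
    refine ⟨?_⟩
    rw [withDensity_apply _ MeasurableSet.univ, Measure.restrict_univ,
      ← ofReal_integral_eq_lintegral_ofReal (S.integrable_dens θ z)
        (Eventually.of_forall (S.dens_nonneg θ z)), S.integral_dens, ENNReal.ofReal_one]
  exact Measure.isProbabilityMeasure_map S.measurable_map.aemeasurable

lemma measurable_uncurry_dens [MeasurableSpace Θ] [BorelSpace Θ] [SecondCountableTopology Θ] :
    Measurable fun q : (Θ × Z) × W => D q.1.1 q.1.2 q.2 := by
  have h := UnifLip.measurable_uncurry (f := fun θ (p : Z × W) => D θ p.1 p.2) S.dens_lip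
    S.measurable_dens
  exact h.comp (f := fun q : (Θ × Z) × W => (q.1.1, (q.1.2, q.2))) (by fun_prop)

lemma measurable_densKernel [MeasurableSpace Θ] [BorelSpace Θ] [SecondCountableTopology Θ] :
    Measurable fun p : Θ × Z => densKernel B Φ D p.1 p.2 := by
  have := S.finite_base
  refine Measure.measurable_of_measurable_coe _ fun A hA => ?_
  have hA' := S.measurable_map hA
  simp_rw [densKernel, Measure.map_apply S.measurable_map hA, withDensity_apply _ hA']
  exact S.measurable_uncurry_dens.ennreal_ofReal.lintegral_prod_right'

/-- The mass of the minorizing measure. -/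
lemma mass_le_one [Nonempty Θ] [Nonempty Z] : δ * B.real Set.univ ≤ 1 := by
  have := S.finite_base
  obtain ⟨θ⟩ := ‹Nonempty Θ›
  obtain ⟨z⟩ := ‹Nonempty Z›
  rw [← S.integral_dens θ z, mul_comm, ← smul_eq_mul, ← integral_const]
  exact integral_mono (integrable_const _) (S.integrable_dens θ z) (S.le_dens θ z)

/-- If `B` were zero, no density could integrate to `1`. -/
lemma mass_pos [Nonempty Θ] [Nonempty Z] : 0 < δ * B.real Set.univ := by
  have := S.finite_base
  obtain ⟨θ⟩ := ‹Nonempty Θ›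
  obtain ⟨z⟩ := ‹Nonempty Z›
  refine mul_pos S.δ_pos ?_
  rw [measureReal_def, ENNReal.toReal_pos_iff]
  refine ⟨?_, measure_lt_top _ _⟩
  rw [pos_iff_ne_zero]
  intro h
  have h1 := S.integral_dens θ z
  rw [Measure.measure_univ_eq_zero.1 h, integral_zero_measure] at h1
  exact zero_ne_one h1

/-- The residual kernel, acting on functions, is a contraction. -/
lemma norm_integral_residual_le (θ : Θ) (z : Z) {f : Z → F} {M : ℝ} (hf : ∀ z, ‖f z‖ ≤ M) :
    ‖∫ w, (D θ z w - δ) • f (Φ w) ∂B‖ ≤ (1 - δ * B.real Set.univ) * M := by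
  have := S.finite_base
  have hi : Integrable (fun w => D θ z w - δ) B := (S.integrable_dens θ z).sub (integrable_const _)
  calc _ ≤ ∫ w, (D θ z w - δ) * M ∂B := by
        refine norm_integral_le_of_norm_le (hi.mul_const M) (Eventually.of_forall fun w => ?_)
        rw [norm_smul, Real.norm_of_nonneg (sub_nonneg.2 (S.le_dens θ z w))]
        exact mul_le_mul_of_nonneg_left (hf _) (sub_nonneg.2 (S.le_dens θ z w))
    _ = _ := by
        rw [integral_mul_const, integral_sub (S.integrable_dens θ z) (integrable_const _),
          S.integral_dens, integral_const, smul_eq_mul, mul_comm δ]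

lemma integrable_smul_comp {d : W → ℝ} (hd : Integrable d B) {f : Z → F}
    (hm : StronglyMeasurable f) {M : ℝ} (hf : ∀ z, ‖f z‖ ≤ M) :
    Integrable (fun w => d w • f (Φ w)) B :=
  hd.smul_bdd M (hm.comp_measurable S.measurable_map).aestronglyMeasurable
    (Eventually.of_forall fun w => hf (Φ w))

end basic

/-- The iterates of the residual kernel applied to `H`. -/
def residualIter (B : Measure W) (Φ : W → Z) (D : Θ → Z → W → ℝ) (δ : ℝ) (H : Θ → Z → F) :
    ℕ → Θ → Z → F
  | 0 => H
  | n + 1 => fun θ z => ∫ w, (D θ z w - δ) • residualIter B Φ D δ H n θ (Φ w) ∂B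

/-- The solution of the Poisson equation. -/
def poisson (B : Measure W) (Φ : W → Z) (D : Θ → Z → W → ℝ) (δ : ℝ) (H : Θ → Z → F) (θ : Θ) (z : Z) :
    F := ∑' n, residualIter B Φ D δ H n θ z

/-- The stationary mean of `H θ`. -/
def statMean (B : Measure W) (Φ : W → Z) (D : Θ → Z → W → ℝ) (δ : ℝ) (H : Θ → Z → F) (θ : Θ) : F :=
  δ • ∫ w, poisson B Φ D δ H θ (Φ w) ∂B

section iterates

variable (S : MinorizedFamily B Φ D δ) {H : Θ → Z → F}
include S

lemma norm_residualIter_le {M : ℝ} (hM : ∀ θ z, ‖H θ z‖ ≤ M) (n : ℕ) (θ : Θ) (z : Z) :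
    ‖residualIter B Φ D δ H n θ z‖ ≤ (1 - δ * B.real Set.univ) ^ n * M := by
  induction n generalizing z with
  | zero => simpa [residualIter] using hM θ z
  | succ n ih =>
    rw [pow_succ', mul_assoc]
    exact S.norm_integral_residual_le θ z ih

variable [MeasurableSpace Θ] [BorelSpace Θ] [SecondCountableTopology Θ]

lemma stronglyMeasurable_residualIter (hH : StronglyMeasurable (Function.uncurry H)) (n : ℕ) :
    StronglyMeasurable (Function.uncurry (residualIter B Φ D δ H n)) := by
  have := S.finite_base
  induction n with
  | zero => exact hH
  | succ n ih =>
    refine StronglyMeasurable.integral_prod_right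
      (f := fun (p : Θ × Z) w => (D p.1 p.2 w - δ) • residualIter B Φ D δ H n p.1 (Φ w)) ?_
    refine (S.measurable_uncurry_dens.sub_const δ).stronglyMeasurable.smul ?_
    have := S.measurable_map
    exact ih.comp_measurable (g := fun q : (Θ × Z) × W => (q.1.1, Φ q.2)) (by fun_prop)

lemma stronglyMeasurable_residualIter_right (hH : StronglyMeasurable (Function.uncurry H)) (n : ℕ)
    (θ : Θ) : StronglyMeasurable (residualIter B Φ D δ H n θ) :=
  (S.stronglyMeasurable_residualIter hH n).comp_measurable
    (measurable_prodMk_left (x := θ))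

end iterates

section poisson

variable (S : MinorizedFamily B Φ D δ) [Nonempty Z] {H : Θ → Z → F}
include S

lemma summable_geometric (M : ℝ) :
    Summable fun n : ℕ => (1 - δ * B.real Set.univ) ^ n * M :=
  (summable_geometric_of_lt_one (sub_nonneg.2 S.mass_le_one)
    (by linarith [S.mass_pos])).mul_right M

lemma norm_poisson_le {M : ℝ} (hM : ∀ θ z, ‖H θ z‖ ≤ M) (θ : Θ) (z : Z) :
    ‖poisson B Φ D δ H θ z‖ ≤ (δ * B.real Set.univ)⁻¹ * M := by
  refine tsum_of_norm_bounded ?_ (fun n => S.norm_residualIter_le hM n θ z)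
  have := (hasSum_geometric_of_lt_one (sub_nonneg.2 S.mass_le_one)
    (by linarith [S.mass_pos])).mul_right M
  rwa [sub_sub_cancel] at this

variable [MeasurableSpace Θ] [BorelSpace Θ] [SecondCountableTopology Θ] [CompleteSpace F]

lemma stronglyMeasurable_poisson (hH : StronglyMeasurable (Function.uncurry H)) {M : ℝ}
    (hM : ∀ θ z, ‖H θ z‖ ≤ M) :
    StronglyMeasurable (Function.uncurry (poisson B Φ D δ H)) := by
  refine stronglyMeasurable_of_tendsto atTop
    (f := fun n p => ∑ k ∈ Finset.range n, Function.uncurry (residualIter B Φ D δ H k) p)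
    (fun n => Finset.stronglyMeasurable_fun_sum _
      fun k _ => S.stronglyMeasurable_residualIter hH k) ?_
  rw [tendsto_pi_nhds]
  rintro ⟨θ, z⟩
  exact ((S.summable_geometric M).of_norm_bounded
    fun n => S.norm_residualIter_le hM n θ z).hasSum.tendsto_sum_nat

lemma stronglyMeasurable_poisson_right (hH : StronglyMeasurable (Function.uncurry H)) {M : ℝ}
    (hM : ∀ θ z, ‖H θ z‖ ≤ M) (θ : Θ) : StronglyMeasurable (poisson B Φ D δ H θ) :=
  (S.stronglyMeasurable_poisson hH hM).comp_measurable (measurable_prodMk_left (x := θ))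

/-- The resolvent of the residual kernel. -/
lemma poisson_eq_add_residual (hH : StronglyMeasurable (Function.uncurry H)) {M : ℝ}
    (hM : ∀ θ z, ‖H θ z‖ ≤ M) (θ : Θ) (z : Z) :
    poisson B Φ D δ H θ z = H θ z + ∫ w, (D θ z w - δ) • poisson B Φ D δ H θ (Φ w) ∂B := by
  have := S.finite_base
  have hi : Integrable (fun w => D θ z w - δ) B := (S.integrable_dens θ z).sub (integrable_const _)
  have hs : ∀ z, Summable fun n => residualIter B Φ D δ H n θ z := fun z =>
    (S.summable_geometric M).of_norm_bounded fun n => S.norm_residualIter_le hM n θ z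
  -- The residual kernel may be applied to the series term by term because the norms are dominated
  -- by a geometric series.
  have key : HasSum (fun n => ∫ w, (D θ z w - δ) • residualIter B Φ D δ H n θ (Φ w) ∂B)
      (∫ w, ∑' n, (D θ z w - δ) • residualIter B Φ D δ H n θ (Φ w) ∂B) := by
    refine hasSum_integral_of_summable_integral_norm (fun n => S.integrable_smul_comp hi
      (S.stronglyMeasurable_residualIter_right hH n θ)
      (fun z => S.norm_residualIter_le hM n θ z)) ?_
    refine (S.summable_geometric ((∫ w, (D θ z w - δ) ∂B) * M)).of_nonneg_of_le
      (fun n => integral_nonneg fun w => norm_nonneg _) fun n => ?_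
    calc _ ≤ ∫ w, (D θ z w - δ) * ((1 - δ * B.real Set.univ) ^ n * M) ∂B := by
          refine integral_mono (S.integrable_smul_comp hi
            (S.stronglyMeasurable_residualIter_right hH n θ)
            (fun z => S.norm_residualIter_le hM n θ z)).norm (hi.mul_const _) fun w => ?_
          simp only [norm_smul]
          rw [Real.norm_of_nonneg (sub_nonneg.2 (S.le_dens θ z w))]
          exact mul_le_mul_of_nonneg_left (S.norm_residualIter_le hM n θ _)
            (sub_nonneg.2 (S.le_dens θ z w))
      _ = _ := by rw [integral_mul_const]; ring
  rw [poisson, (hs z).tsum_eq_zero_add]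
  congr 1
  have h2 : ∀ n, residualIter B Φ D δ H (n + 1) θ z
      = ∫ w, (D θ z w - δ) • residualIter B Φ D δ H n θ (Φ w) ∂B := fun n => rfl
  simp_rw [h2]
  rw [key.tsum_eq]
  refine integral_congr_ae (Eventually.of_forall fun w => ?_)
  exact ((hs (Φ w)).tsum_const_smul (D θ z w - δ))

/-- The Poisson equation. -/
lemma poisson_sub_integral (hH : StronglyMeasurable (Function.uncurry H)) {M : ℝ}
    (hM : ∀ θ z, ‖H θ z‖ ≤ M) (θ : Θ) (z : Z) :
    ∫ z', poisson B Φ D δ H θ z' ∂densKernel B Φ D θ z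
      = poisson B Φ D δ H θ z - H θ z + statMean B Φ D δ H θ := by
  have := S.finite_base
  have hG := S.stronglyMeasurable_poisson_right hH hM θ
  have hGM := S.norm_poisson_le hM θ
  have h := S.poisson_eq_add_residual hH hM θ z
  simp_rw [sub_smul] at h
  rw [integral_sub (S.integrable_smul_comp (S.integrable_dens θ z) hG hGM)
    (S.integrable_smul_comp (integrable_const δ) hG hGM), integral_smul] at h
  rw [S.integral_densKernel θ z hG, statMean]
  generalize ∫ w, D θ z w • poisson B Φ D δ H θ (Φ w) ∂B = a at h ⊢
  rw [h]
  abel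

/-- Subtracting `G = H + R G` at two parameters gives `H_θ - H_θ'`, plus `R_θ` applied to `G_θ -
G_θ'`, plus the change of density integrated against `G_θ'`. The middle term is at most `1 - b`
times the supremum of the difference, so the inequality can be solved for that supremum. -/
lemma poisson_lip (hH : StronglyMeasurable (Function.uncurry H))
    (hL : UnifLip fun z θ => H θ z) : UnifLip fun z θ => poisson B Φ D δ H θ z := by
  have := S.finite_base
  obtain ⟨M, hM0, hM⟩ := hL
  obtain ⟨L, hL0, hL⟩ := S.dens_lip
  have hHM : ∀ θ z, ‖H θ z‖ ≤ M := fun θ z => (hM z θ θ).1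
  set b := δ * B.real Set.univ with hb
  have hb0 : 0 < b := S.mass_pos
  have hGM := S.norm_poisson_le hHM
  rw [← hb] at hGM
  -- `M` comes from the change of `H`. The other term is the Lipschitz constant of the density times
  -- the bound `b⁻¹ * M` on `G` times the mass of `B`.
  set A := M + L * (b⁻¹ * M) * B.real Set.univ with hA
  refine ⟨b⁻¹ * M + b⁻¹ * A, by positivity, fun z θ θ' => ⟨(hGM θ z).trans ?_, ?_⟩⟩
  · have : 0 ≤ b⁻¹ * A := by positivity
    linarith
  set f : Z → ℝ := fun z => ‖poisson B Φ D δ H θ z - poisson B Φ D δ H θ' z‖ with hf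
  -- Boundedness makes the real supremum a genuine upper bound rather than the default `0`.
  have hbdd : BddAbove (Set.range f) := by
    refine ⟨b⁻¹ * M + b⁻¹ * M, ?_⟩
    rintro _ ⟨z, rfl⟩
    exact (norm_sub_le _ _).trans (add_le_add (hGM θ z) (hGM θ' z))
  have hmain : ∀ z, f z ≤ A * ‖θ - θ'‖ + (1 - b) * ⨆ z, f z := by
    intro z
    have hi : ∀ θ, Integrable (fun w => D θ z w - δ) B := fun θ =>
      (S.integrable_dens θ z).sub (integrable_const _)
    have hG := S.stronglyMeasurable_poisson_right hH hHM
    have e : poisson B Φ D δ H θ z - poisson B Φ D δ H θ' z = (H θ z - H θ' z)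
        + ((∫ w, (D θ z w - δ) • (poisson B Φ D δ H θ (Φ w) - poisson B Φ D δ H θ' (Φ w)) ∂B)
        + ∫ w, (D θ z w - D θ' z w) • poisson B Φ D δ H θ' (Φ w) ∂B) := by
      rw [S.poisson_eq_add_residual hH hHM θ z, S.poisson_eq_add_residual hH hHM θ' z,
        add_sub_add_comm]
      congr 1
      have i1 := S.integrable_smul_comp (hi θ) (hG θ) (hGM θ)
      have i2 := S.integrable_smul_comp (hi θ) (hG θ') (hGM θ')
      have i3 := S.integrable_smul_comp (hi θ') (hG θ') (hGM θ')
      have i4 : Integrable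
          (fun w => (D θ z w - D θ' z w) • poisson B Φ D δ H θ' (Φ w)) B :=
        S.integrable_smul_comp ((S.integrable_dens θ z).sub (S.integrable_dens θ' z))
          (hG θ') (hGM θ')
      rw [← integral_sub i1 i3, ← integral_add 
        ((i1.sub i2).congr (Eventually.of_forall fun w => (smul_sub _ _ _).symm)) i4]
      refine integral_congr_ae (Eventually.of_forall fun w => ?_)
      simp only [smul_sub, sub_smul]
      abel
    have h1 : ‖H θ z - H θ' z‖ ≤ M * ‖θ - θ'‖ := (hM z θ θ').2
    have h2 := S.norm_integral_residual_le θ z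
      (f := fun z => poisson B Φ D δ H θ z - poisson B Φ D δ H θ' z) (fun z => le_ciSup hbdd z)
    have h3 : ‖∫ w, (D θ z w - D θ' z w) • poisson B Φ D δ H θ' (Φ w) ∂B‖
        ≤ L * ‖θ - θ'‖ * (b⁻¹ * M) * B.real Set.univ := by
      refine norm_integral_le_of_norm_le_const (Eventually.of_forall fun w => ?_)
      rw [norm_smul]
      exact mul_le_mul (hL (z, w) θ θ').2 (hGM θ' _) (norm_nonneg _) (by positivity)
    calc f z ≤ ‖H θ z - H θ' z‖ + (‖∫ w, (D θ z w - δ) • (poisson B Φ D δ H θ (Φ w)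
          - poisson B Φ D δ H θ' (Φ w)) ∂B‖
          + ‖∫ w, (D θ z w - D θ' z w) • poisson B Φ D δ H θ' (Φ w) ∂B‖) := by
          rw [hf]
          simp only
          rw [e]
          exact (norm_add_le _ _).trans (by gcongr; exact norm_add_le _ _)
      _ ≤ M * ‖θ - θ'‖ + ((1 - b) * (⨆ z, f z) + L * ‖θ - θ'‖ * (b⁻¹ * M) * B.real Set.univ) :=
          add_le_add h1 (add_le_add h2 h3)
      _ = _ := by rw [hA]; ring
  have hsup : (⨆ z, f z) ≤ A * ‖θ - θ'‖ + (1 - b) * ⨆ z, f z := ciSup_le hmain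
  have hsup' : (⨆ z, f z) ≤ b⁻¹ * A * ‖θ - θ'‖ := by
    rw [mul_assoc, inv_mul_eq_div, le_div_iff₀ hb0]
    linarith
  refine (le_ciSup hbdd z).trans (hsup'.trans ?_)
  gcongr
  have : 0 ≤ b⁻¹ * M := by positivity
  linarith

lemma statMean_lip (hH : StronglyMeasurable (Function.uncurry H))
    (hL : UnifLip fun z θ => H θ z) :
    ∃ K : ℝ, ∀ θ θ', ‖statMean B Φ D δ H θ - statMean B Φ D δ H θ'‖ ≤ K * ‖θ - θ'‖ := by
  have := S.finite_base
  obtain ⟨K, hK0, hK⟩ := S.poisson_lip hH hL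
  obtain ⟨M, hM0, hM⟩ := hL
  have hHM : ∀ θ z, ‖H θ z‖ ≤ M := fun θ z => (hM z θ θ).1
  have hi : ∀ θ, Integrable (fun w => poisson B Φ D δ H θ (Φ w)) B := fun θ => by
    simpa using S.integrable_smul_comp (integrable_const 1)
      (S.stronglyMeasurable_poisson_right hH hHM θ) (S.norm_poisson_le hHM θ)
  refine ⟨δ * (K * B.real Set.univ), fun θ θ' => ?_⟩
  rw [statMean, statMean, ← smul_sub, ← integral_sub (hi θ) (hi θ'), norm_smul,
    Real.norm_of_nonneg S.δ_pos.le, mul_assoc]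
  refine mul_le_mul_of_nonneg_left ?_ S.δ_pos.le
  rw [mul_right_comm]
  exact norm_integral_le_of_norm_le_const (Eventually.of_forall fun w => (hK (Φ w) θ θ').2)

end poisson

end MinorizedFamily

/-! ### Existence and uniqueness of stationary distributions. -/

namespace MinorizedFamily

variable {Θ Z W F : Type*} [NormedAddCommGroup Θ] [MeasurableSpace Z] [MeasurableSpace W]
  {B : Measure W} {Φ : W → Z} {D : Θ → Z → W → ℝ} {δ : ℝ}

section stationary

variable [MeasurableSpace Θ] [BorelSpace Θ] [SecondCountableTopology Θ]
  (S : MinorizedFamily B Φ D δ)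
include S

lemma measurable_densKernel_right (θ : Θ) : Measurable (densKernel B Φ D θ) :=
  Measurable.comp (g := fun p : Θ × Z => densKernel B Φ D p.1 p.2) (f := fun z => (θ, z))
    S.measurable_densKernel measurable_prodMk_left

/-- A stationary distribution is invariant under the kernel. -/
lemma bind_eq_of_stationary {θ : Θ} {π : Measure Z}
    (hπ : ∀ A, MeasurableSet A → ∫⁻ z, densKernel B Φ D θ z A ∂π = π A) :
    π.bind (densKernel B Φ D θ) = π := by
  refine Measure.ext fun A hA => ?_
  rw [Measure.bind_apply hA (S.measurable_densKernel_right θ).aemeasurable]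
  exact hπ A hA

/-- The mean of `H θ` under any stationary distribution is `statMean`. -/
lemma integral_stationary [NormedAddCommGroup F] [NormedSpace ℝ F] [CompleteSpace F]
    {H : Θ → Z → F} (hH : StronglyMeasurable (Function.uncurry H)) {M : ℝ}
    (hM : ∀ θ z, ‖H θ z‖ ≤ M) {θ : Θ} {π : Measure Z} [IsProbabilityMeasure π]
    (hπ : ∀ A, MeasurableSet A → ∫⁻ z, densKernel B Φ D θ z A ∂π = π A) :
    ∫ z, H θ z ∂π = statMean B Φ D δ H θ := by
  have : Nonempty Z := π.nonempty_of_neZero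
  have hG := S.stronglyMeasurable_poisson_right hH hM θ
  have hGi : ∀ (ρ : Measure Z) [IsFiniteMeasure ρ], Integrable (poisson B Φ D δ H θ) ρ :=
    fun ρ _ => .of_bound hG.aestronglyMeasurable _ (Eventually.of_forall (S.norm_poisson_le hM θ))
  have hHi : Integrable (H θ) π := .of_bound
    (hH.comp_measurable (measurable_prodMk_left (x := θ))).aestronglyMeasurable _
    (Eventually.of_forall (hM θ))
  let κ : Kernel Z Z := ⟨densKernel B Φ D θ, S.measurable_densKernel_right θ⟩
  have hbind : π.bind κ = π := S.bind_eq_of_stationary hπ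
  have : IsMarkovKernel κ := ⟨S.isProbabilityMeasure θ⟩
  have h1 : ∫ z, poisson B Φ D δ H θ z ∂π
      = ∫ z, ∫ z', poisson B Φ D δ H θ z' ∂(densKernel B Φ D θ z) ∂π := by
    have hsnd : (π ⊗ₘ κ).map Prod.snd = π := (Measure.snd_compProd π κ).trans hbind
    have h2 := Measure.integral_compProd (μ := π) (κ := κ)
      (f := fun p => poisson B Φ D δ H θ p.2) (.of_bound
        (hG.comp_measurable measurable_snd).aestronglyMeasurable _
        (Eventually.of_forall fun p => S.norm_poisson_le hM θ p.2))
    refine Eq.trans ?_ h2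
    rw [← integral_map measurable_snd.aemeasurable hG.aestronglyMeasurable, hsnd]
  -- Integrating the Poisson equation against `π`, the two means of `G` cancel, leaving the mean of
  -- `H` equal to `statMean`.
  simp_rw [S.poisson_sub_integral hH hM] at h1
  rw [integral_add (f := fun z => poisson B Φ D δ H θ z - H θ z) ((hGi π).sub hHi)
    (integrable_const _), integral_sub (hGi π) hHi,
    integral_const, probReal_univ, one_smul, sub_add, eq_comm, sub_eq_self, sub_eq_zero] at h1
  exact h1

/-- For the indicator of a set, `statMean` is built from the kernel alone, yet it equals the mass
that any stationary law gives to that set. -/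
lemma stationary_unique {θ : Θ} {π π' : Measure Z} [IsProbabilityMeasure π]
    [IsProbabilityMeasure π']
    (hπ : ∀ A, MeasurableSet A → ∫⁻ z, densKernel B Φ D θ z A ∂π = π A)
    (hπ' : ∀ A, MeasurableSet A → ∫⁻ z, densKernel B Φ D θ z A ∂π' = π' A) : π = π' := by
  refine Measure.ext fun A hA => ?_
  have hH : StronglyMeasurable
      (Function.uncurry fun (_ : Θ) (z : Z) => A.indicator (1 : Z → ℝ) z) :=
    (stronglyMeasurable_one.indicator hA).comp_measurable measurable_snd
  have hM : ∀ (_ : Θ) (z : Z), ‖A.indicator (1 : Z → ℝ) z‖ ≤ 1 := fun _ z => by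
    by_cases hz : z ∈ A <;> simp [hz]
  have h := (S.integral_stationary hH hM hπ).trans (S.integral_stationary hH hM hπ').symm
  rw [integral_indicator_one hA, integral_indicator_one hA] at h
  exact (measureReal_eq_measureReal_iff).1 h

/-- A minorized kernel has a stationary distribution. -/
lemma exists_stationary [Nonempty Z] (θ : Θ) : ∃ π : Measure Z, IsProbabilityMeasure π ∧
    ∀ A, MeasurableSet A → ∫⁻ z, densKernel B Φ D θ z A ∂π = π A := by
  have := S.finite_base
  -- The kernel is split into the residual `R` and the state-independent part `ρ₀`.
  let R : Z → Measure Z := fun z =>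
    (B.withDensity fun w => ENNReal.ofReal (D θ z w - δ)).map Φ
  let ρ₀ : Measure Z := (B.withDensity fun _ => ENNReal.ofReal δ).map Φ
  have hRm : Measurable R := by
    refine Measure.measurable_of_measurable_coe _ fun A hA => ?_
    have hA' := S.measurable_map hA
    simp_rw [R, Measure.map_apply S.measurable_map hA, withDensity_apply _ hA']
    exact ((S.measurable_dens θ).sub_const δ).ennreal_ofReal.lintegral_prod_right'
  have hTm : Measurable (densKernel B Φ D θ) :=
    S.measurable_densKernel_right θ
  have hsplit : ∀ z, densKernel B Φ D θ z = R z + ρ₀ := by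
    intro z
    rw [densKernel, ← Measure.map_add _ _ S.measurable_map,
      ← withDensity_add_right (μ := B) (fun w => ENNReal.ofReal (D θ z w - δ))
        (g := fun _ => ENNReal.ofReal δ) measurable_const]
    congr 2
    funext w
    simp only [Pi.add_apply]
    rw [← ENNReal.ofReal_add (sub_nonneg.2 (S.le_dens θ z w)) S.δ_pos.le,
      sub_add_cancel]
  have hρ₀ : ρ₀ Set.univ = ENNReal.ofReal (δ * B.real Set.univ) := by
    rw [Measure.map_apply S.measurable_map MeasurableSet.univ, Set.preimage_univ,
      withDensity_const, Measure.smul_apply, smul_eq_mul, ENNReal.ofReal_mul S.δ_pos.le,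
      ofReal_measureReal]
  have hb0 : 0 < δ * B.real Set.univ := S.mass_pos
  have hb1 : δ * B.real Set.univ ≤ 1 := S.mass_le_one
  set b := δ * B.real Set.univ
  have hRuniv : ∀ z, R z Set.univ = ENNReal.ofReal (1 - b) := by
    intro z
    have h1 := S.isProbabilityMeasure θ z
    have h2 : densKernel B Φ D θ z Set.univ = 1 := measure_univ
    rw [hsplit, Measure.add_apply, hρ₀] at h2
    rw [ENNReal.ofReal_sub _ hb0.le, ENNReal.ofReal_one]
    exact ENNReal.eq_sub_of_add_eq ENNReal.ofReal_ne_top h2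
  -- `ρ n` is `ρ₀ R^n`, of mass `b (1 - b)^n`; these masses sum to `1`.
  let ρ : ℕ → Measure Z := fun n => n.rec ρ₀ fun _ m => m.bind R
  have hρs : ∀ n, ρ (n + 1) = (ρ n).bind R := fun n => rfl
  have hρu : ∀ n, ρ n Set.univ = ENNReal.ofReal (b * (1 - b) ^ n) := by
    intro n
    induction n with
    | zero => simpa [ρ] using hρ₀
    | succ n ih =>
      rw [hρs, Measure.bind_apply MeasurableSet.univ hRm.aemeasurable]
      simp_rw [hRuniv]
      rw [lintegral_const, ih, ← ENNReal.ofReal_mul (sub_nonneg.2 hb1)]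
      congr 1
      ring
  have hprob : IsProbabilityMeasure (Measure.sum ρ) := by
    refine ⟨?_⟩
    rw [Measure.sum_apply _ MeasurableSet.univ]
    simp_rw [hρu]
    have hg := (hasSum_geometric_of_lt_one (sub_nonneg.2 hb1) (by linarith)).mul_left b
    rw [sub_sub_cancel, mul_inv_cancel₀ hb0.ne'] at hg
    rw [← ENNReal.ofReal_tsum_of_nonneg
      (fun n => mul_nonneg hb0.le (pow_nonneg (sub_nonneg.2 hb1) n)) hg.summable, hg.tsum_eq,
      ENNReal.ofReal_one]
  -- Invariance is a shift of the series: `R` sends `ρ n` to `ρ (n + 1)`, and the missing term `ρ₀`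
  -- is contributed by the constant part, as the total mass is `1`.
  refine ⟨Measure.sum ρ, hprob, fun A hA => ?_⟩
  simp_rw [hsplit, Measure.add_apply]
  rw [lintegral_add_right _ measurable_const, lintegral_const, measure_univ, mul_one,
    lintegral_sum_measure, Measure.sum_apply _ hA, 
    tsum_eq_zero_add' (f := fun n => ρ n A) ENNReal.summable, add_comm]
  congr 1
  refine tsum_congr fun n => ?_
  rw [hρs, Measure.bind_apply hA hRm.aemeasurable]

end stationary

end MinorizedFamily

/-! ### Densities of product measures. -/

lemma lintegral_pi_prod {n : ℕ} {X : Type*} [MeasurableSpace X] {μ : Measure X} [SigmaFinite μ]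
    {f : Fin n → X → ENNReal} (hf : ∀ i, Measurable (f i)) :
    ∫⁻ x : Fin n → X, ∏ i, f i (x i) ∂(Measure.pi fun _ => μ) = ∏ i, ∫⁻ x, f i x ∂μ := by
  induction n with
  | zero => simp
  | succ n ih =>
    calc _ = ∫⁻ x : X × (Fin n → X), f 0 x.1 * ∏ i : Fin n, f (Fin.succ i) (x.2 i)
            ∂(μ.prod (Measure.pi fun _ => μ)) := by
          rw [← ((measurePreserving_piFinSuccAbove (fun _ => μ) 0).symm).lintegral_comp
            (by fun_prop)]
          simp_rw [MeasurableEquiv.piFinSuccAbove_symm_apply, Fin.insertNthEquiv,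
            Fin.prod_univ_succ, Fin.insertNth_zero, Equiv.coe_fn_mk, Fin.cons_succ, Fin.cons_zero]
          rfl
      _ = (∫⁻ x, f 0 x ∂μ) * ∏ i : Fin n, ∫⁻ x, f (Fin.succ i) x ∂μ := by
          rw [← ih fun i => hf (Fin.succ i)]
          exact lintegral_prod_mul (hf 0).aemeasurable
            (Finset.measurable_fun_prod _ fun i _ =>
              (hf (Fin.succ i)).comp (measurable_pi_apply i)).aemeasurable
      _ = _ := by rw [Fin.prod_univ_succ]

/-- It suffices to compare boxes, where the indicator factorizes over coordinates. This yields the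
joint density of independently proposed particles. -/
lemma pi_withDensity {n : ℕ} {X : Type*} [MeasurableSpace X] {μ : Measure X} [SigmaFinite μ]
    {f : Fin n → X → ENNReal} (hf : ∀ i, Measurable (f i))
    (hs : ∀ i, SigmaFinite (μ.withDensity (f i))) :
    Measure.pi (fun i => μ.withDensity (f i))
      = (Measure.pi fun _ => μ).withDensity fun x => ∏ i, f i (x i) := by
  refine Measure.pi_eq fun s hs => ?_
  rw [withDensity_apply _ (MeasurableSet.univ_pi hs), ← lintegral_indicator
    (MeasurableSet.univ_pi hs)]
  have : ∀ x : Fin n → X, (Set.univ.pi s).indicator (fun x => ∏ i, f i (x i)) x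
      = ∏ i, (s i).indicator (f i) (x i) := by
    intro x
    by_cases hx : x ∈ Set.univ.pi s
    · rw [Set.indicator_of_mem hx]
      exact Finset.prod_congr rfl fun i _ => (Set.indicator_of_mem (hx i trivial) _).symm
    · rw [Set.indicator_of_notMem hx]
      simp only [Set.mem_pi, Set.mem_univ, true_imp_iff, not_forall] at hx
      obtain ⟨i, hi⟩ := hx
      exact (Finset.prod_eq_zero (Finset.mem_univ i) (Set.indicator_of_notMem hi _)).symm
  simp_rw [this]
  rw [lintegral_pi_prod fun i => (hf i).indicator (hs i)]
  refine Finset.prod_congr rfl fun i _ => ?_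
  rw [lintegral_indicator (hs i), withDensity_apply _ (hs i)]

lemma UnifLip.of_bounds {α Θ : Type*} [NormedAddCommGroup Θ] {f : α → Θ → ℝ} {ε κ : ℝ}
    (hε : 0 < ε) (hκ : 0 ≤ κ) (h : ∀ a θ, ε ≤ f a θ ∧ f a θ ≤ 1 / ε)
    (h' : ∀ a θ θ', |f a θ - f a θ'| ≤ κ * ‖θ - θ'‖) : UnifLip f := by
  have : 0 ≤ 1 / ε := by positivity
  refine ⟨1 / ε + κ, by positivity, fun a θ θ' => ⟨?_, (h' a θ θ').trans ?_⟩⟩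
  · rw [Real.norm_of_nonneg (hε.le.trans (h a θ).1)]
    linarith [(h a θ).2]
  · have := mul_nonneg this (norm_nonneg (θ - θ'))
    rw [add_mul]
    linarith

/-! ### The transition kernel as the image of a density on an enlarged space. -/

namespace Model

variable {d : ℕ} {X Y E : Type*} [MeasurableSpace X] [MeasurableSpace Y] [MeasurableSpace E]
  {N : ℕ} (S : Model d X Y E)

/-- Proposed particles, ancestor indices and noise, together with the next state and observation. -/
abbrev Draw (N : ℕ) (X Y E : Type*) : Type _ :=
  (X × Y) × ((Fin N → X) × (Fin N → Fin N)) × (Fin N → E)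

/-- Resampling: replace the proposed particles by the selected ones. -/
def relabel (w : Draw N X Y E) : State N X Y E := (w.1, (fun j => w.2.1.1 (w.2.1.2 j)), w.2.2)

/-- The reference measure for the transitions. -/
def base (N : ℕ) : Measure (Draw N X Y E) :=
  ((S.μ.prod S.η).withDensity fun p => ENNReal.ofReal (S.gbar p.1 p.2)).prod
    (((Measure.pi fun _ => S.μ).prod Measure.count).prod (Measure.pi fun _ => S.ν))

/-- The density of proposed particles and ancestor indices. -/
def particleDens (θ : Param d) (xt : Fin N → X) (y : Y) (q : (Fin N → X) × (Fin N → Fin N)) : ℝ :=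
  (∏ k, S.r θ (xt k) (q.1 k) y) * ∏ j, S.selectProb θ xt q.1 y (q.2 j)

/-- The density of the transition kernel. -/
def dens (θ : Param d) (z : State N X Y E) (w : Draw N X Y E) : ℝ :=
  S.mbar z.1.1 w.1.1 * S.particleDens θ z.2.1 z.1.2 w.2.1

/-- There are only finitely many ancestor maps, so measurability may be checked with the map held
fixed. -/
lemma measurable_select :
    Measurable fun q : (Fin N → X) × (Fin N → Fin N) => fun j => q.1 (q.2 j) := by
  refine measurable_from_prod_countable_left fun I => ?_
  exact measurable_pi_iff.2 fun j => measurable_pi_apply (I j)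

lemma measurable_relabel : Measurable (relabel : Draw N X Y E → State N X Y E) := by
  refine measurable_fst.prodMk (Measurable.prodMk ?_ (by fun_prop))
  exact measurable_select.comp (f := fun w : Draw N X Y E => w.2.1) (by fun_prop)

variable {S}

lemma Regular.measurable_weight (h : S.Regular) (θ : Param d) :
    Measurable fun p : X × X × Y => S.weight θ p.1 p.2.1 p.2.2 := by
  have h1 := (h.measurable_m θ).comp (f := fun p : X × X × Y => (p.1, p.2.1)) (by fun_prop)
  have h2 := (h.measurable_g θ).comp (f := fun p : X × X × Y => (p.2.1, p.2.2)) (by fun_prop)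
  exact (h1.mul h2).div (h.measurable_r θ)

lemma Regular.measurable_selectProb (h : S.Regular) (θ : Param d) (i : Fin N) :
    Measurable fun p : (Fin N → X) × (Fin N → X) × Y => S.selectProb θ p.1 p.2.1 p.2.2 i := by
  have h1 : ∀ i : Fin N, Measurable fun p : (Fin N → X) × (Fin N → X) × Y =>
      S.weight θ (p.1 i) (p.2.1 i) p.2.2 := fun i =>
    (h.measurable_weight θ).comp
      (f := fun p : (Fin N → X) × (Fin N → X) × Y => (p.1 i, p.2.1 i, p.2.2)) (by fun_prop)
  exact (h1 i).div (Finset.measurable_fun_sum _ fun l _ => h1 l)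

lemma Regular.measurable_particleDens (h : S.Regular) (θ : Param d) :
    Measurable fun p : ((Fin N → X) × Y) × ((Fin N → X) × (Fin N → Fin N)) =>
      S.particleDens θ p.1.1 p.1.2 p.2 := by
  refine Measurable.mul (Finset.measurable_fun_prod _ fun k _ => ?_)
    (Finset.measurable_fun_prod _ fun j _ => ?_)
  · exact (h.measurable_r θ).comp
      (f := fun p : ((Fin N → X) × Y) × ((Fin N → X) × (Fin N → Fin N)) =>
        (p.1.1 k, p.2.1 k, p.1.2)) (by fun_prop)
  · have : Measurable fun p : (((Fin N → X) × Y) × (Fin N → X)) × (Fin N → Fin N) =>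
        S.selectProb θ p.1.1.1 p.1.2 p.1.1.2 (p.2 j) := by
      refine measurable_from_prod_countable_left fun I => ?_
      exact (h.measurable_selectProb θ (I j)).comp
        (f := fun p : ((Fin N → X) × Y) × (Fin N → X) => (p.1.1, p.2, p.1.2)) (by fun_prop)
    exact this.comp
      (f := fun p : ((Fin N → X) × Y) × ((Fin N → X) × (Fin N → Fin N)) =>
        ((p.1, p.2.1), p.2.2)) (by fun_prop)

lemma Regular.measurable_dens (h : S.Regular) (θ : Param d) :
    Measurable fun p : State N X Y E × Draw N X Y E => S.dens θ p.1 p.2 := by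
  have h1 := h.measurable_mbar.comp
    (f := fun p : State N X Y E × Draw N X Y E => (p.1.1.1, p.2.1.1)) (by fun_prop)
  have h2 := (h.measurable_particleDens (N := N) θ).comp
    (f := fun p : State N X Y E × Draw N X Y E => ((p.1.2.1, p.1.1.2), p.2.2.1)) (by fun_prop)
  exact h1.mul h2

lemma Regular.weight_nonneg (h : S.Regular) (θ : Param d) (x x' : X) (y : Y) :
    0 ≤ S.weight θ x x' y :=
  div_nonneg (mul_nonneg (h.m_nonneg _ _ _) (h.g_nonneg _ _ _)) (h.r_nonneg _ _ _ _)

lemma Regular.selectProb_nonneg (h : S.Regular) (θ : Param d) (xt ξ : Fin N → X) (y : Y)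
    (i : Fin N) : 0 ≤ S.selectProb θ xt ξ y i :=
  div_nonneg (h.weight_nonneg _ _ _ _) (Finset.sum_nonneg fun _ _ => h.weight_nonneg _ _ _ _)

lemma Regular.particleDens_nonneg (h : S.Regular) (θ : Param d) (xt : Fin N → X) (y : Y)
    (q : (Fin N → X) × (Fin N → Fin N)) : 0 ≤ S.particleDens θ xt y q :=
  mul_nonneg (Finset.prod_nonneg fun _ _ => h.r_nonneg _ _ _ _)
    (Finset.prod_nonneg fun _ _ => h.selectProb_nonneg _ _ _ _ _)

lemma Regular.nonempty_Y [Nonempty X] (h : S.Regular) : Nonempty Y := by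
  obtain ⟨x⟩ := ‹Nonempty X›
  by_contra hY
  rw [not_nonempty_iff] at hY
  have := h.lintegral_gbar x
  simp at this

lemma isFiniteMeasure_of_density {α : Type*} [MeasurableSpace α] {μ : Measure α} {ε : ℝ}
    (hε : 0 < ε) {f : α → ℝ} (hf : ∀ a, ε ≤ f a) (h1 : ∫⁻ a, ENNReal.ofReal (f a) ∂μ = 1) :
    IsFiniteMeasure μ := by
  refine ⟨?_⟩
  have h2 : ENNReal.ofReal ε * μ Set.univ ≤ 1 := by
    rw [← lintegral_const, ← h1]
    exact lintegral_mono fun a => ENNReal.ofReal_le_ofReal (hf a)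
  by_contra h
  rw [not_lt, top_le_iff] at h
  rw [h, ENNReal.mul_top (ENNReal.ofReal_pos.2 hε).ne'] at h2
  exact absurd h2 (by simp)

lemma finite_μ [Nonempty X] (h : S.Regular) (hmix : S.StrongMixing) : IsFiniteMeasure S.μ := by
  obtain ⟨y⟩ := h.nonempty_Y
  obtain ⟨ε, hε, -, hb⟩ := hmix
  obtain ⟨x⟩ := ‹Nonempty X›
  exact isFiniteMeasure_of_density hε (fun x' => (hb 0 x x' y).1.1) (h.lintegral_mbar x)

lemma finite_η [Nonempty X] (h : S.Regular) (hmix : S.StrongMixing) : IsFiniteMeasure S.η := by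
  obtain ⟨ε, hε, -, hb⟩ := hmix
  obtain ⟨x⟩ := ‹Nonempty X›
  exact isFiniteMeasure_of_density hε (fun y => (hb 0 x x y).2.2.1.1) (h.lintegral_g 0 x)

lemma prob_proposal (h : S.Regular) (θ : Param d) (x : X) (y : Y) :
    IsProbabilityMeasure (S.μ.withDensity fun x' => ENNReal.ofReal (S.r θ x x' y)) :=
  ⟨by rw [withDensity_apply _ MeasurableSet.univ, Measure.restrict_univ, h.lintegral_r]⟩

/-- `gbar` has no assumed bounds, so it is part of the base measure rather than of the density. This
is possible because it does not involve the current state, and it costs no mass because `gbar` is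
normalized. -/
lemma finite_base [Nonempty X] (h : S.Regular) (hmix : S.StrongMixing) :
    IsFiniteMeasure (S.base N) := by
  have := finite_μ h hmix
  have := finite_η h hmix
  have := h.prob_ν
  have : IsFiniteMeasure
      ((S.μ.prod S.η).withDensity fun p => ENNReal.ofReal (S.gbar p.1 p.2)) := by
    refine ⟨?_⟩
    rw [withDensity_apply _ MeasurableSet.univ, Measure.restrict_univ,
      lintegral_prod _ h.measurable_gbar.ennreal_ofReal.aemeasurable]
    simp_rw [h.lintegral_gbar]
    rw [lintegral_one]
    exact measure_lt_top _ _
  unfold base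
  infer_instance

lemma sum_dirac_apply (θ : Param d) (xt : Fin N → X) (y : Y) {A : Set (Fin N → X)}
    (hA : MeasurableSet A) (ξ : Fin N → X) :
    (∑ I : Fin N → Fin N, (∏ j, ENNReal.ofReal (S.selectProb θ xt ξ y (I j))) •
        Measure.dirac fun j => ξ (I j)) A
      = ∑ I : Fin N → Fin N, (∏ j, ENNReal.ofReal (S.selectProb θ xt ξ y (I j))) *
        A.indicator 1 fun j => ξ (I j) := by
  rw [Measure.finsetSum_apply]
  simp_rw [Measure.smul_apply, Measure.dirac_apply' _ hA, smul_eq_mul]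

lemma measurable_sum_dirac_apply (h : S.Regular) (θ : Param d) (xt : Fin N → X) (y : Y)
    {A : Set (Fin N → X)} (hA : MeasurableSet A) : Measurable fun ξ : Fin N → X =>
      ∑ I : Fin N → Fin N, (∏ j, ENNReal.ofReal (S.selectProb θ xt ξ y (I j))) *
        A.indicator (1 : (Fin N → X) → ENNReal) fun j => ξ (I j) := by
  have hsel : ∀ i, Measurable fun ξ : Fin N → X => S.selectProb θ xt ξ y i := fun i =>
    (h.measurable_selectProb θ i).comp (f := fun ξ : Fin N → X => (xt, ξ, y)) (by fun_prop)
  refine Finset.measurable_fun_sum _ fun I _ => Measurable.mul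
    (Finset.measurable_fun_prod _ fun j _ => (hsel _).ennreal_ofReal) ?_
  exact (measurable_one.indicator hA).comp
    (f := fun (ξ : Fin N → X) j => ξ (I j)) (by fun_prop)

lemma measurable_particleKernel (h : S.Regular) (θ : Param d) (xt : Fin N → X) (y : Y) :
    Measurable fun ξ : Fin N → X => ∑ I : Fin N → Fin N,
      (∏ j, ENNReal.ofReal (S.selectProb θ xt ξ y (I j))) • Measure.dirac fun j => ξ (I j) := by
  refine Measure.measurable_of_measurable_coe _ fun A hA => ?_
  simp_rw [sum_dirac_apply θ xt y hA]
  exact measurable_sum_dirac_apply h θ xt y hA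

/-- Resampled particles can coincide with positive probability, so their law need not have a density
with respect to a product measure. Keeping proposals and ancestor indices restores one: the finite
sum over ancestor maps is an integral against counting measure. -/
lemma particleLaw_eq [Nonempty X] (h : S.Regular) (hmix : S.StrongMixing) (θ : Param d)
    (xt : Fin N → X) (y : Y) :
    S.particleLaw θ xt y = (((Measure.pi fun _ => S.μ).prod Measure.count).withDensity
      fun q => ENNReal.ofReal (S.particleDens θ xt y q)).map fun q j => q.1 (q.2 j) := by
  have := finite_μ h hmix
  have := prob_proposal h θ
  have hr : ∀ k, Measurable fun x' => ENNReal.ofReal (S.r θ (xt k) x' y) := fun k =>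
    ((h.measurable_r θ).comp (f := fun x' : X => (xt k, x', y)) (by fun_prop)).ennreal_ofReal
  have hpd : Measurable fun q => ENNReal.ofReal (S.particleDens θ xt y q) :=
    ((h.measurable_particleDens θ).comp
      (f := fun q : (Fin N → X) × (Fin N → Fin N) => ((xt, y), q)) (by fun_prop)).ennreal_ofReal
  have hrp : Measurable fun x : Fin N → X => ∏ i, ENNReal.ofReal (S.r θ (xt i) (x i) y) :=
    Finset.measurable_fun_prod _ fun k _ => (hr k).comp (measurable_pi_apply k)
  refine Measure.ext fun A hA => ?_
  rw [particleLaw, Measure.bind_apply hA (measurable_particleKernel h θ xt y).aemeasurable,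
    Measure.map_apply measurable_select hA,
    withDensity_apply _ (measurable_select hA), ← lintegral_indicator (measurable_select hA),
    lintegral_prod _ (hpd.indicator (measurable_select hA)).aemeasurable,
    pi_withDensity hr fun i => inferInstance]
  simp_rw [sum_dirac_apply θ xt y hA]
  rw [lintegral_withDensity_eq_lintegral_mul _ hrp (measurable_sum_dirac_apply h θ xt y hA)]
  refine lintegral_congr fun ξ => ?_
  rw [lintegral_count, tsum_fintype, Pi.mul_apply, Finset.mul_sum]
  refine Finset.sum_congr rfl fun I _ => ?_
  by_cases hI : (fun j => ξ (I j)) ∈ A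
  · rw [Set.indicator_of_mem hI, Set.indicator_of_mem (by exact hI), particleDens,
      ENNReal.ofReal_mul (Finset.prod_nonneg fun _ _ => h.r_nonneg _ _ _ _),
      ENNReal.ofReal_prod_of_nonneg fun _ _ => h.r_nonneg _ _ _ _,
      ENNReal.ofReal_prod_of_nonneg fun _ _ => h.selectProb_nonneg _ _ _ _ _]
    simp
  · rw [Set.indicator_of_notMem hI, Set.indicator_of_notMem (by exact hI), mul_zero, mul_zero]

lemma trans_eq_densKernel [Nonempty X] (h : S.Regular) (hmix : S.StrongMixing) (θ : Param d)
    (z : State N X Y E) : S.trans N θ z = densKernel (S.base N) relabel S.dens θ z := by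
  have := finite_μ h hmix
  have := finite_η h hmix
  have := h.prob_ν
  have hpd : Measurable fun q => ENNReal.ofReal (S.particleDens θ z.2.1 z.1.2 q) :=
    ((h.measurable_particleDens θ).comp
      (f := fun q : (Fin N → X) × (Fin N → Fin N) => ((z.2.1, z.1.2), q))
      (by fun_prop)).ennreal_ofReal
  have hpd' : Measurable fun q : ((Fin N → X) × (Fin N → Fin N)) × (Fin N → E) =>
      ENNReal.ofReal (S.particleDens θ z.2.1 z.1.2 q.1) := hpd.comp measurable_fst
  have hmb : Measurable fun p : X × Y => ENNReal.ofReal (S.mbar z.1.1 p.1) :=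
    (h.measurable_mbar.comp (f := fun p : X × Y => (z.1.1, p.1)) (by fun_prop)).ennreal_ofReal
  have hgb : Measurable fun p : X × Y => ENNReal.ofReal (S.gbar p.1 p.2) :=
    h.measurable_gbar.ennreal_ofReal
  -- The identity map is inserted so that `relabel` appears as a product of maps, one on each
  -- factor.
  have e1 : ((S.μ.prod S.η).withDensity
      fun p => ENNReal.ofReal (S.mbar z.1.1 p.1) * ENNReal.ofReal (S.gbar p.1 p.2))
      = (((S.μ.prod S.η).withDensity fun p => ENNReal.ofReal (S.gbar p.1 p.2)).withDensity
          fun p => ENNReal.ofReal (S.mbar z.1.1 p.1)).map id := by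
    rw [Measure.map_id, ← withDensity_mul _ hgb hmb]
    congr 1
    funext p
    exact mul_comm _ _
  have e2 := Measure.map_prod_map (((Measure.pi fun _ => S.μ).prod Measure.count).withDensity
      fun q => ENNReal.ofReal (S.particleDens θ z.2.1 z.1.2 q)) (Measure.pi fun _ : Fin N => S.ν)
      measurable_select measurable_id
  rw [Measure.map_id] at e2
  rw [trans, particleLaw_eq h hmix, e1, e2, Measure.map_prod_map _ _ measurable_id
    (measurable_select.prodMap measurable_id), prod_withDensity_left hpd,
    prod_withDensity hmb hpd', densKernel, base]
  congr 2
  funext w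
  rw [dens, ENNReal.ofReal_mul (h.mbar_nonneg _ _)]

end Model

/-! ### Bounds and normalization of the transition density. -/

namespace Model

variable {d : ℕ} {X Y E : Type*} [MeasurableSpace X] [MeasurableSpace Y] [MeasurableSpace E]
  {N : ℕ} {S : Model d X Y E}

lemma le_weight {ε : ℝ} (hε : 0 < ε) {a b c : ℝ} (ha : ε ≤ a) (hb : ε ≤ b) (hc : ε ≤ c)
    (hc' : c ≤ 1 / ε) : ε * ε * ε ≤ a * b / c := by
  have h1 : ε ≤ c⁻¹ := by
    rw [le_inv_comm₀ hε (hε.trans_le hc), ← one_div]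
    exact hc'
  rw [div_eq_mul_inv]
  exact mul_le_mul (mul_le_mul ha hb hε.le (hε.le.trans ha)) h1 hε.le
    (mul_nonneg (hε.le.trans ha) (hε.le.trans hb))

lemma weight_lip [Nonempty X] [Nonempty Y] [Nonempty E] (hmix : S.StrongMixing)
    (hlip : S.LipschitzGradients) :
    (UnifLip fun (p : X × X × Y) θ => S.weight θ p.1 p.2.1 p.2.2) ∧
    UnifLip fun (p : X × X × Y) θ => S.r θ p.1 p.2.1 p.2.2 := by
  obtain ⟨ε, hε, -, hb⟩ := hmix
  obtain ⟨-, κ, hκ, hL⟩ := hlip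
  have hκ0 : 0 ≤ κ := zero_le_one.trans hκ
  have y₀ : Y := Classical.arbitrary Y
  have x₀ : X := Classical.arbitrary X
  have v₀ : E := Classical.arbitrary E
  have hm : UnifLip fun (p : X × X × Y) θ => S.m θ p.1 p.2.1 := .of_bounds hε hκ0
    (fun p θ => (hb θ p.1 p.2.1 p.2.2).2.1) fun p θ θ' => (hL θ θ' p.1 p.2.1 p.2.2 v₀).2.1.1
  have hg : UnifLip fun (p : X × X × Y) θ => S.g θ p.2.1 p.2.2 := .of_bounds hε hκ0
    (fun p θ => (hb θ p.2.1 x₀ p.2.2).2.2.1) fun p θ θ' => (hL θ θ' p.2.1 x₀ p.2.2 v₀).2.2.1.1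
  have hr : UnifLip fun (p : X × X × Y) θ => S.r θ p.1 p.2.1 p.2.2 := .of_bounds hε hκ0
    (fun p θ => (hb θ p.1 p.2.1 p.2.2).2.2.2) fun p θ θ' => (hL θ θ' p.1 p.2.1 p.2.2 v₀).2.2.2.1
  refine ⟨?_, hr⟩
  simp_rw [weight, div_eq_mul_inv]
  exact (hm.mul hg).mul (hr.inv hε fun p θ => (hb θ p.1 p.2.1 p.2.2).2.2.2.1)

/-- Each weight is at least `ε³` and the total weight is bounded above, so no selection probability
degenerates. The index in `Fin N` provides a summand that keeps the total weight away from zero. -/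
lemma selectProb_bounds [Nonempty X] [Nonempty Y] [Nonempty E] (hmix : S.StrongMixing)
    (hlip : S.LipschitzGradients) :
    (UnifLip fun (p : (Fin N → X) × (Fin N → X) × Y × Fin N) θ =>
      S.selectProb θ p.1 p.2.1 p.2.2.1 p.2.2.2) ∧
    (∃ σ : ℝ, 0 < σ ∧ ∀ θ (xt ξ : Fin N → X) y i, σ ≤ S.selectProb θ xt ξ y i) ∧
    ∀ θ (xt ξ : Fin N → X) y (_ : Fin N), 0 < ∑ l, S.weight θ (xt l) (ξ l) y := by
  have hw := (weight_lip hmix hlip).1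
  obtain ⟨ε, hε, -, hb⟩ := hmix
  have hwl : ∀ θ x x' y, ε * ε * ε ≤ S.weight θ x x' y := fun θ x x' y =>
    le_weight hε (hb θ x x' y).2.1.1 (hb θ x' x y).2.2.1.1 (hb θ x x' y).2.2.2.1
      (hb θ x x' y).2.2.2.2
  have hε3 : 0 < ε * ε * ε := by positivity
  have hsum : UnifLip fun (p : (Fin N → X) × (Fin N → X) × Y × Fin N) θ =>
      ∑ l, S.weight θ (p.1 l) (p.2.1 l) p.2.2.1 := .sum _ fun l =>
    hw.comp_index fun p : (Fin N → X) × (Fin N → X) × Y × Fin N => (p.1 l, p.2.1 l, p.2.2.1)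
  have hsl : ∀ θ (xt ξ : Fin N → X) y (_ : Fin N),
      ε * ε * ε ≤ ∑ l, S.weight θ (xt l) (ξ l) y := fun θ xt ξ y i =>
    (hwl θ (xt i) (ξ i) y).trans <| Finset.single_le_sum
      (f := fun l => S.weight θ (xt l) (ξ l) y)
      (fun l _ => hε3.le.trans (hwl _ _ _ _)) (Finset.mem_univ i)
  refine ⟨?_, ?_, fun θ xt ξ y i => hε3.trans_le (hsl θ xt ξ y i)⟩
  · simp_rw [selectProb, div_eq_mul_inv]
    exact (hw.comp_index fun p : (Fin N → X) × (Fin N → X) × Y × Fin N =>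
      (p.1 p.2.2.2, p.2.1 p.2.2.2, p.2.2.1)).mul
      (hsum.inv hε3 fun p θ => hsl θ p.1 p.2.1 p.2.2.1 p.2.2.2)
  · obtain ⟨K, hK, h⟩ := hsum
    -- `K` bounds the total weight; `K + 1` is positive even when `K = 0`.
    refine ⟨ε * ε * ε / (K + 1), by positivity, fun θ xt ξ y i => ?_⟩
    refine div_le_div₀ (hε3.le.trans (hwl _ _ _ _)) (hwl _ _ _ _)
      (hε3.trans_le (hsl θ xt ξ y i)) ?_
    have := (h (xt, ξ, y, i) θ θ).1
    exact (le_abs_self _).trans (this.trans (by linarith))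

lemma sum_selectProb (hN : 0 < N) [Nonempty X] [Nonempty Y] [Nonempty E] (hmix : S.StrongMixing)
    (hlip : S.LipschitzGradients) (θ : Param d) (xt ξ : Fin N → X) (y : Y) :
    ∑ i, S.selectProb θ xt ξ y i = 1 := by
  simp_rw [selectProb]
  rw [← Finset.sum_div]
  exact div_self ((selectProb_bounds hmix hlip).2.2 θ xt ξ y ⟨0, hN⟩).ne'

lemma particleLaw_prob (hN : 0 < N) [Nonempty X] [Nonempty Y] [Nonempty E] (h : S.Regular)
    (hmix : S.StrongMixing) (hlip : S.LipschitzGradients) (θ : Param d) (xt : Fin N → X) (y : Y) :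
    S.particleLaw θ xt y Set.univ = 1 := by
  have := finite_μ h hmix
  have := prob_proposal h θ
  have hone : ∀ ξ : Fin N → X, (∑ I : Fin N → Fin N,
      (∏ j, ENNReal.ofReal (S.selectProb θ xt ξ y (I j))) •
        Measure.dirac fun j => ξ (I j)) Set.univ = 1 := by
    intro ξ
    rw [Measure.finsetSum_apply]
    simp_rw [Measure.smul_apply, measure_univ, smul_eq_mul, mul_one]
    -- Summing over all ancestor maps the product of selection probabilities gives the product of
    -- their sums, each equal to `1`.
    rw [← Fintype.prod_sum fun (_ : Fin N) i => ENNReal.ofReal (S.selectProb θ xt ξ y i)]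
    rw [← ENNReal.ofReal_sum_of_nonneg fun i _ => h.selectProb_nonneg _ _ _ _ _,
      sum_selectProb hN hmix hlip]
    simp
  rw [particleLaw, Measure.bind_apply MeasurableSet.univ
    (measurable_particleKernel h θ xt y).aemeasurable]
  simp_rw [hone]
  simp

lemma trans_prob (hN : 0 < N) [Nonempty X] [Nonempty Y] [Nonempty E] (h : S.Regular)
    (hmix : S.StrongMixing) (hlip : S.LipschitzGradients) (θ : Param d) (z : State N X Y E) :
    S.trans N θ z Set.univ = 1 := by
  have := finite_μ h hmix
  have := finite_η h hmix
  have := h.prob_ν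
  have h1 : ((S.μ.prod S.η).withDensity fun p =>
      ENNReal.ofReal (S.mbar z.1.1 p.1) * ENNReal.ofReal (S.gbar p.1 p.2)) Set.univ = 1 := by
    have hm : Measurable fun x' => ENNReal.ofReal (S.mbar z.1.1 x') :=
      (h.measurable_mbar.comp (f := fun x' : X => (z.1.1, x')) (by fun_prop)).ennreal_ofReal
    have hmg : Measurable fun p : X × Y =>
        ENNReal.ofReal (S.mbar z.1.1 p.1) * ENNReal.ofReal (S.gbar p.1 p.2) :=
      (hm.comp measurable_fst).mul h.measurable_gbar.ennreal_ofReal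
    rw [withDensity_apply _ MeasurableSet.univ, Measure.restrict_univ, lintegral_prod _
      hmg.aemeasurable]
    have hg : ∀ x, Measurable fun y => ENNReal.ofReal (S.gbar x y) := fun x =>
      (h.measurable_gbar.comp (f := fun y : Y => (x, y)) (by fun_prop)).ennreal_ofReal
    simp_rw [lintegral_const_mul _ (hg _), h.lintegral_gbar, mul_one]
    exact h.lintegral_mbar _
  have : IsProbabilityMeasure (S.particleLaw θ z.2.1 z.1.2) :=
    ⟨particleLaw_prob hN h hmix hlip θ _ _⟩
  rw [trans, ← Set.univ_prod_univ, Measure.prod_prod, h1, measure_univ, mul_one]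

lemma minorizedFamily (hN : 0 < N) [Nonempty X] (h : S.Regular) (hmix : S.StrongMixing)
    (hlip : S.LipschitzGradients) :
    ∃ δ, MinorizedFamily (S.base N) relabel S.dens δ := by
  have := finite_μ h hmix
  have := finite_base (N := N) h hmix
  have := h.nonempty_Y
  have : Nonempty E := by
    have := h.prob_ν
    exact S.ν.nonempty_of_neZero
  obtain ⟨hsl, ⟨σ, hσ, hσl⟩, -⟩ := selectProb_bounds (N := N) hmix hlip
  have hr := (weight_lip hmix hlip).2
  have hmix' := hmix
  obtain ⟨ε, hε, -, hb⟩ := hmix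
  -- One factor `ε` from `mbar`, `ε ^ N` from the proposals, `σ ^ N` from the ancestor choices.
  refine ⟨ε * (ε ^ N * σ ^ N), inferInstance, measurable_relabel, h.measurable_dens, by positivity,
    fun θ z w => ?_, ?_, fun θ z => ?_⟩
  · have h1 : ε ^ N ≤ ∏ k, S.r θ (z.2.1 k) (w.2.1.1 k) z.1.2 := by
      simpa using Finset.prod_le_prod (s := Finset.univ) (f := fun _ : Fin N => ε)
        (fun _ _ => hε.le) (fun k _ => (hb θ (z.2.1 k) (w.2.1.1 k) z.1.2).2.2.2.1)
    have h2 : σ ^ N ≤ ∏ j, S.selectProb θ z.2.1 w.2.1.1 z.1.2 (w.2.1.2 j) := by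
      simpa using Finset.prod_le_prod (s := Finset.univ) (f := fun _ : Fin N => σ)
        (fun _ _ => hσ.le) (fun j _ => hσl θ z.2.1 w.2.1.1 z.1.2 (w.2.1.2 j))
    have h3 := (hb θ z.1.1 w.1.1 z.1.2).1.1
    exact mul_le_mul h3 (mul_le_mul h1 h2 (by positivity) ((by positivity : 0 ≤ ε ^ N).trans h1))
      (by positivity) (hε.le.trans h3)
  · have hmb : UnifLip fun (p : State N X Y E × Draw N X Y E) (_ : Param d) =>
        S.mbar p.1.1.1 p.2.1.1 := by
      refine .const ⟨1 / ε, fun p => ?_⟩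
      have := (hb 0 p.1.1.1 p.2.1.1 p.1.1.2).1
      rw [Real.norm_of_nonneg (hε.le.trans this.1)]
      exact this.2
    refine hmb.mul ((UnifLip.prod _ fun k => ?_).mul (UnifLip.prod _ fun j => ?_))
    · exact hr.comp_index fun p : State N X Y E × Draw N X Y E =>
        (p.1.2.1 k, p.2.2.1.1 k, p.1.1.2)
    · exact hsl.comp_index fun p : State N X Y E × Draw N X Y E =>
        (p.1.2.1, p.2.2.1.1, p.1.1.2, p.2.2.1.2 j)
  -- The density integrates to `1` because it represents the transition law, already known to have
  -- mass `1`.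
  · have h1 := trans_prob hN h hmix' hlip θ z
    rw [trans_eq_densKernel h hmix', densKernel, Measure.map_apply measurable_relabel
      MeasurableSet.univ, Set.preimage_univ, withDensity_apply _ MeasurableSet.univ,
      Measure.restrict_univ] at h1
    have hd : Measurable (S.dens θ z) := (h.measurable_dens θ).comp measurable_prodMk_left
    rw [integral_eq_lintegral_of_nonneg_ae (Eventually.of_forall fun w => ?_)
      hd.aestronglyMeasurable, h1, ENNReal.toReal_one]
    exact mul_nonneg (h.mbar_nonneg _ _) (h.particleDens_nonneg _ _ _ _)

end Model

/-! ### Regularity of the gradient estimate. -/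

/-- The gradient of a parametric family of measurable functions is measurable. -/
lemma measurable_gradient_of_param {α : Type*} [MeasurableSpace α] {d : ℕ} {f : Param d → α → ℝ}
    (hf : ∀ θ, Measurable (f θ)) (hd : ∀ a, Differentiable ℝ fun θ => f θ a) (θ : Param d) :
    Measurable fun a => gradient (fun θ => f θ a) θ := by
  have h1 : ∀ v : Param d, Measurable fun a => fderiv ℝ (fun θ => f θ a) θ v := by
    intro v
    refine measurable_of_tendsto_metrizable (f := fun (n : ℕ) a =>
      (n : ℝ) • (f (θ + (n : ℝ)⁻¹ • v) a - f θ a))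
      (fun n => ((hf _).sub (hf _)).const_smul (n : ℝ)) ?_
    rw [tendsto_pi_nhds]
    intro a
    exact (hd a θ).hasFDerivAt.lim v (tendsto_norm_atTop_atTop.comp tendsto_natCast_atTop_atTop)
  have h2 : ∀ a, gradient (fun θ => f θ a) θ = ∑ i : Fin d,
      fderiv ℝ (fun θ => f θ a) θ (EuclideanSpace.basisFun (Fin d) ℝ i) •
        EuclideanSpace.basisFun (Fin d) ℝ i := by
    intro a
    conv_lhs => rw [← (EuclideanSpace.basisFun (Fin d) ℝ).sum_repr' (gradient _ θ)]
    refine Finset.sum_congr rfl fun i _ => ?_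
    rw [real_inner_comm, gradient, InnerProductSpace.toDual_symm_apply]
  simp_rw [h2]
  exact Finset.measurable_fun_sum _ fun i _ => (h1 _).smul_const _

namespace Model

variable {d : ℕ} {X Y E : Type*} [MeasurableSpace X] [MeasurableSpace Y] [MeasurableSpace E]
  {N : ℕ} {S : Model d X Y E}

lemma unifSmooth_of_gradient {α : Type*} {f : α → Param d → ℝ} (hd : ∀ a, Differentiable ℝ (f a))
    (hf : UnifLip f) {κ : ℝ} (hκ : 0 ≤ κ) (h1 : ∀ a θ, ‖gradient (f a) θ‖ ≤ κ)
    (h2 : ∀ a θ θ', ‖gradient (f a) θ - gradient (f a) θ'‖ ≤ κ * ‖θ - θ'‖) : UnifSmooth f := by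
  refine ⟨hd, hf, UnifLip.of_norm_eq (f := fun a θ => gradient (f a) θ)
    ⟨κ, hκ, fun a θ θ' => ⟨h1 a θ, h2 a θ θ'⟩⟩ (fun a θ => ?_) fun a θ θ' => ?_⟩
  · rw [gradient, LinearIsometryEquiv.norm_map]
  · rw [gradient, gradient, ← map_sub, LinearIsometryEquiv.norm_map]

/-- The weights, evaluated along the reparameterization, are products and quotients of the smooth
families `mF`, `gF`, `rF`. Their sum stays above `ε³` since there is at least one particle, so its
logarithm has a bounded Lipschitz gradient. -/
lemma gradEst_props (hN : 0 < N) [Nonempty X] (h : S.Regular) (hmix : S.StrongMixing)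
    (hlip : S.LipschitzGradients) : (UnifLip fun z θ => S.gradEst N θ z) ∧
      ∀ θ, Measurable (S.gradEst N θ) := by
  obtain ⟨ε, hε, -, hb⟩ := hmix
  obtain ⟨hd, κ, hκ, hL⟩ := hlip
  have hκ0 : 0 ≤ κ := zero_le_one.trans hκ
  have hm : UnifSmooth fun (p : X × Y × E) θ => S.mF p.1 p.2.1 p.2.2 θ :=
    unifSmooth_of_gradient (fun p => (hd _ _ _).1) (.of_bounds hε hκ0
      (fun p θ => (hb θ p.1 _ p.2.1).2.1) fun p θ θ' => (hL θ θ' p.1 p.1 p.2.1 p.2.2).2.1.2.1) hκ0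
      (fun p θ => (hL θ θ p.1 p.1 p.2.1 p.2.2).1.1)
      fun p θ θ' => (hL θ θ' p.1 p.1 p.2.1 p.2.2).2.1.2.2
  have hg : UnifSmooth fun (p : X × Y × E) θ => S.gF p.1 p.2.1 p.2.2 θ :=
    unifSmooth_of_gradient (fun p => (hd _ _ _).2.1) (.of_bounds hε hκ0
      (fun p θ => (hb θ _ p.1 p.2.1).2.2.1)
      fun p θ θ' => (hL θ θ' p.1 p.1 p.2.1 p.2.2).2.2.1.2.1) hκ0
      (fun p θ => (hL θ θ p.1 p.1 p.2.1 p.2.2).1.2.1)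
      fun p θ θ' => (hL θ θ' p.1 p.1 p.2.1 p.2.2).2.2.1.2.2
  have hr : UnifSmooth fun (p : X × Y × E) θ => S.rF p.1 p.2.1 p.2.2 θ :=
    unifSmooth_of_gradient (fun p => (hd _ _ _).2.2) (.of_bounds hε hκ0
      (fun p θ => (hb θ p.1 _ p.2.1).2.2.2)
      fun p θ θ' => (hL θ θ' p.1 p.1 p.2.1 p.2.2).2.2.2.2.1) hκ0
      (fun p θ => (hL θ θ p.1 p.1 p.2.1 p.2.2).1.2.2)
      fun p θ θ' => (hL θ θ' p.1 p.1 p.2.1 p.2.2).2.2.2.2.2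
  have hw : UnifSmooth fun (p : X × Y × E) θ =>
      S.weight θ p.1 (S.F θ p.1 p.2.1 p.2.2) p.2.1 := by
    simp_rw [weight, div_eq_mul_inv]
    exact (hm.mul hg).mul (hr.inv hε fun p θ => (hb θ p.1 _ p.2.1).2.2.2.1)
  have hε3 : 0 < ε * ε * ε := by positivity
  have hwl : ∀ θ x x' y, ε * ε * ε ≤ S.weight θ x x' y := fun θ x x' y =>
    le_weight hε (hb θ x x' y).2.1.1 (hb θ x' x y).2.2.1.1 (hb θ x x' y).2.2.2.1
      (hb θ x x' y).2.2.2.2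
  have hs : UnifSmooth fun (z : State N X Y E) θ =>
      ∑ i, S.weight θ (z.2.1 i) (S.F θ (z.2.1 i) z.1.2 (z.2.2 i)) z.1.2 :=
    .sum _ fun i => hw.comp_index fun z : State N X Y E => (z.2.1 i, z.1.2, z.2.2 i)
  have hsl : ∀ (z : State N X Y E) θ, ε * ε * ε ≤
      ∑ i, S.weight θ (z.2.1 i) (S.F θ (z.2.1 i) z.1.2 (z.2.2 i)) z.1.2 := fun z θ =>
    (hwl θ _ _ _).trans <| Finset.single_le_sum
      (f := fun i => S.weight θ (z.2.1 i) (S.F θ (z.2.1 i) z.1.2 (z.2.2 i)) z.1.2)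
      (fun l _ => hε3.le.trans (hwl _ _ _ _)) (Finset.mem_univ (⟨0, hN⟩ : Fin N))
  constructor
  · refine UnifLip.of_norm_eq (hs.fderiv_log_lip hε3 hsl) (fun z θ => ?_) fun z θ θ' => ?_
    · rw [gradEst, gradient, LinearIsometryEquiv.norm_map]
    · rw [gradEst, gradEst, gradient, gradient, ← map_sub, LinearIsometryEquiv.norm_map]
  · refine measurable_gradient_of_param (f := fun θ (z : State N X Y E) => Real.log
      (∑ i, S.weight θ (z.2.1 i) (S.F θ (z.2.1 i) z.1.2 (z.2.2 i)) z.1.2)) (fun θ => ?_)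
      fun z => (hs.diff z).log fun θ => (hε3.trans_le (hsl z θ)).ne'
    refine Measurable.log (Finset.measurable_fun_sum _ fun i _ => ?_)
    have hF := (h.measurable_F θ).comp
      (f := fun z : State N X Y E => (z.2.1 i, z.1.2, z.2.2 i)) (by fun_prop)
    exact (h.measurable_weight θ).comp (g := fun p : X × X × Y => S.weight θ p.1 p.2.1 p.2.2)
      (f := fun z : State N X Y E => (z.2.1 i, S.F θ (z.2.1 i) z.1.2 (z.2.2 i), z.1.2))
      (Measurable.prodMk (by fun_prop) (hF.prodMk (by fun_prop)))

end Model

/-! ### Step sizes, Abel summation and the quadratic bound for `V`. -/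

lemma stepSize_nonneg {c : ℝ} (hc : 0 < c) (t : ℕ) : 0 ≤ stepSize c t :=
  div_nonneg hc.le (Real.sqrt_nonneg _)

lemma stepSize_anti {c : ℝ} (hc : 0 < c) (t : ℕ) : stepSize c (t + 2) ≤ stepSize c (t + 1) := by
  refine div_le_div_of_nonneg_left hc.le (Real.sqrt_pos.2 (by positivity)) (Real.sqrt_le_sqrt ?_)
  push_cast
  linarith

lemma stepSize_one (c : ℝ) : stepSize c 1 = c := by simp [stepSize]

lemma sum_stepSize_sq_le (c : ℝ) (n : ℕ) :
    ∑ s ∈ Finset.range n, stepSize c (s + 1) ^ 2 ≤ c ^ 2 * (1 + Real.log n) := by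
  have h : ∑ s ∈ Finset.range n, stepSize c (s + 1) ^ 2 = c ^ 2 * (harmonic n : ℝ) := by
    rw [harmonic, Rat.cast_sum, Finset.mul_sum]
    refine Finset.sum_congr rfl fun s _ => ?_
    rw [stepSize, div_pow, Real.sq_sqrt (by positivity)]
    push_cast
    rfl
  rw [h]
  exact mul_le_mul_of_nonneg_left (harmonic_le_one_add_log n) (sq_nonneg c)

lemma le_sum_stepSize {c : ℝ} (hc : 0 < c) (t : ℕ) :
    c * Real.sqrt t ≤ ∑ k ∈ Finset.range (t + 1), stepSize c (k + 1) := by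
  have hpos : 0 < Real.sqrt (t + 1 : ℝ) := Real.sqrt_pos.2 (by positivity)
  calc c * Real.sqrt t ≤ c * Real.sqrt (t + 1) := by
        gcongr
        linarith
    _ = ∑ _k ∈ Finset.range (t + 1), c / Real.sqrt (t + 1) := by
        rw [Finset.sum_const, Finset.card_range, nsmul_eq_mul]
        push_cast
        rw [mul_div_assoc', eq_div_iff hpos.ne', mul_assoc, Real.mul_self_sqrt (by positivity)]
        ring
    _ ≤ _ := by
        refine Finset.sum_le_sum fun k hk => ?_
        refine div_le_div_of_nonneg_left hc.le (Real.sqrt_pos.2 (by positivity))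
          (Real.sqrt_le_sqrt ?_)
        have : k + 1 ≤ t + 1 := Finset.mem_range.1 hk
        exact_mod_cast this

/-- Abel summation of a drift inequality perturbed by increments of a bounded sequence. -/
lemma sum_le_of_drift {γ v b e : ℕ → ℝ} {BV K A : ℝ} (hγ : ∀ s, γ (s + 2) ≤ γ (s + 1))
    (hγ0 : ∀ s, 0 ≤ γ s) (hv : ∀ s, |v s| ≤ BV) (hb : ∀ s, |b s| ≤ K)
    (h : ∀ s, γ (s + 1) * e s
      ≤ v (s + 1) - v s + γ (s + 1) * (b (s + 1) - b s) + A * γ (s + 1) ^ 2) (n : ℕ) :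
    ∑ s ∈ Finset.range n, γ (s + 1) * e s
      ≤ 2 * BV + 2 * γ 1 * K + A * ∑ s ∈ Finset.range n, γ (s + 1) ^ 2 := by
  have key : ∑ s ∈ Finset.range n, γ (s + 1) * e s
      ≤ v n - v 0 + (γ (n + 1) * b n - γ 1 * b 0) + (γ 1 - γ (n + 1)) * K
        + A * ∑ s ∈ Finset.range n, γ (s + 1) ^ 2 := by
    induction n with
    | zero => simp
    | succ n ih =>
      rw [Finset.sum_range_succ, Finset.sum_range_succ]
      have h1 := h n
      -- The new boundary term has coefficient `γ (n + 1)`. Lowering it to `γ (n + 2)` leaves this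
      -- nonnegative multiple of `b (n + 1)`, and the decreases of `γ` telescope.
      have h2 : (γ (n + 1) - γ (n + 2)) * b (n + 1) ≤ (γ (n + 1) - γ (n + 2)) * K :=
        mul_le_mul_of_nonneg_left ((le_abs_self _).trans (hb _)) (sub_nonneg.2 (hγ n))
      have e : n + 1 + 1 = n + 2 := rfl
      rw [e]
      linarith
  have h1 := abs_le.1 (hv n)
  have h2 := abs_le.1 (hv 0)
  have h3 : γ (n + 1) * b n ≤ γ (n + 1) * K :=
    mul_le_mul_of_nonneg_left ((le_abs_self _).trans (hb _)) (hγ0 _)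
  have h4 : γ 1 * (-K) ≤ γ 1 * b 0 :=
    mul_le_mul_of_nonneg_left (abs_le.1 (hb 0)).1 (hγ0 _)
  linarith

lemma average_le {v b e : ℕ → ℝ} {BV K A c : ℝ} (hc : 0 < c) (hA : 0 ≤ A) (hv : ∀ s, |v s| ≤ BV)
    (hb : ∀ s, |b s| ≤ K)
    (h : ∀ s, stepSize c (s + 1) * e s ≤ v (s + 1) - v s
      + stepSize c (s + 1) * (b (s + 1) - b s) + A * stepSize c (s + 1) ^ 2)
    {t : ℕ} (ht : 2 ≤ t) :
    (∑ s ∈ Finset.range (t + 1), stepSize c (s + 1) * e s) /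
        ∑ k ∈ Finset.range (t + 1), stepSize c (k + 1)
      ≤ (4 * BV + 4 * c * K + 4 * (A * c ^ 2)) / c * (Real.log t / Real.sqrt t) := by
  have h1 := sum_le_of_drift (stepSize_anti hc) (stepSize_nonneg hc) hv hb h (t + 1)
  rw [stepSize_one] at h1
  have h2 := mul_le_mul_of_nonneg_left (sum_stepSize_sq_le c (t + 1)) hA
  have ht' : (2 : ℝ) ≤ t := by exact_mod_cast ht
  -- For `t ≥ 2`, `log t > 1/2` and `t + 1 ≤ t ^ 2`, so constants and `log (t + 1)` are absorbed
  -- into multiples of `log t`.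
  have hlog : 1 ≤ 2 * Real.log t := by
    have := Real.log_two_gt_d9
    have := Real.log_le_log two_pos ht'
    linarith
  have hlog' : Real.log (t + 1 : ℕ) ≤ 2 * Real.log t := by
    rw [← Real.log_rpow (by linarith) 2, Real.rpow_two]
    refine Real.log_le_log (by positivity) ?_
    push_cast
    nlinarith
  have hBV : 0 ≤ BV := (abs_nonneg _).trans (hv 0)
  have hK : 0 ≤ K := (abs_nonneg _).trans (hb 0)
  have hAc : 0 ≤ A * c ^ 2 := by positivity
  have hcK : 0 ≤ c * K := by positivity
  have hnum : ∑ s ∈ Finset.range (t + 1), stepSize c (s + 1) * e s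
      ≤ (4 * BV + 4 * c * K + 4 * (A * c ^ 2)) * Real.log t := by
    have i1 := mul_le_mul_of_nonneg_left hlog hBV
    have i2 := mul_le_mul_of_nonneg_left hlog hcK
    have i3 := mul_le_mul_of_nonneg_left (add_le_add hlog hlog') hAc
    rw [← mul_assoc] at h2
    linarith
  have hden := le_sum_stepSize hc t
  have hst : 0 < Real.sqrt t := Real.sqrt_pos.2 (by linarith)
  have hlt : 0 ≤ Real.log t := by linarith
  calc _ ≤ ((4 * BV + 4 * c * K + 4 * (A * c ^ 2)) * Real.log t) / (c * Real.sqrt t) := by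
        refine div_le_div₀ (mul_nonneg (by linarith) hlt) hnum (by positivity) hden
    _ = _ := by field_simp

/-- Lower quadratic bound for a function with Lipschitz gradient. -/
lemma le_of_gradient_lipschitz {F : Type*} [NormedAddCommGroup F] [InnerProductSpace ℝ F]
    [CompleteSpace F] {V : F → ℝ} {h : F → F} (hV : ∀ θ, HasGradientAt V (h θ) θ) {L : ℝ}
    (hL0 : 0 ≤ L) (hL : ∀ θ θ', ‖h θ - h θ'‖ ≤ L * ‖θ - θ'‖) (θ u : F) :
    V θ + inner ℝ (h θ) u - L * ‖u‖ ^ 2 ≤ V (θ + u) := by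
  have hder : ∀ x : ℝ, HasDerivAt (fun x : ℝ => V (θ + x • u)) (inner ℝ (h (θ + x • u)) u) x := by
    intro x
    have h1 : HasDerivAt (fun x : ℝ => θ + x • u) u x := by
      simpa using ((hasDerivAt_id x).smul_const u).const_add θ
    have h2 := (hV (θ + x • u)).hasFDerivAt.comp_hasDerivAt x h1
    simp only [InnerProductSpace.toDual_apply_apply] at h2
    exact h2
  -- The mean value theorem along the segment gives the constant `L` instead of the sharp `L / 2`,
  -- which is enough here.
  obtain ⟨ξ, hξ, hs⟩ := exists_hasDerivAt_eq_slope (fun x : ℝ => V (θ + x • u))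
    (fun x => inner ℝ (h (θ + x • u)) u) one_pos
    (fun x _ => (hder x).continuousAt.continuousWithinAt) fun x _ => hder x
  simp only [one_smul, zero_smul, add_zero, sub_zero, div_one] at hs
  have h3 : |inner ℝ (h (θ + ξ • u) - h θ) u| ≤ L * ‖u‖ ^ 2 := by
    refine (abs_real_inner_le_norm _ _).trans ?_
    have h4 : ‖h (θ + ξ • u) - h θ‖ ≤ L * ‖u‖ := by
      refine (hL _ _).trans (mul_le_mul_of_nonneg_left ?_ hL0)
      rw [add_sub_cancel_left, norm_smul, Real.norm_of_nonneg hξ.1.le]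
      exact mul_le_of_le_one_left (norm_nonneg _) hξ.2.le
    calc _ ≤ L * ‖u‖ * ‖u‖ := mul_le_mul_of_nonneg_right h4 (norm_nonneg _)
      _ = _ := by ring
  rw [inner_sub_left] at h3
  linarith [(abs_le.1 h3).1]

/-! ### Stationarity, Poisson equation and Markov property for the particle chain. -/

namespace Model

variable {d : ℕ} {X Y E : Type*} [MeasurableSpace X] [MeasurableSpace Y] [MeasurableSpace E]
  {N : ℕ} {S : Model d X Y E}

lemma nonempty_state [Nonempty X] (h : S.Regular) : Nonempty (State N X Y E) := by
  have := h.nonempty_Y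
  have : Nonempty E := by
    have := h.prob_ν
    exact S.ν.nonempty_of_neZero
  infer_instance

lemma measurable_gradEst_uncurry (hN : 0 < N) [Nonempty X] (h : S.Regular) (hmix : S.StrongMixing)
    (hlip : S.LipschitzGradients) :
    StronglyMeasurable (Function.uncurry (S.gradEst N)) :=
  (gradEst_props hN h hmix hlip).1.stronglyMeasurable_uncurry
    fun θ => ((gradEst_props hN h hmix hlip).2 θ).stronglyMeasurable

lemma existsUnique_stationary (hN : 0 < N) [Nonempty X] (h : S.Regular) (hmix : S.StrongMixing)
    (hlip : S.LipschitzGradients) (θ : Param d) : ∃! π, S.IsStationary N θ π := by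
  have := nonempty_state (N := N) h
  obtain ⟨δ, M⟩ := minorizedFamily hN h hmix hlip
  have htr : S.trans N θ = densKernel (S.base N) relabel S.dens θ :=
    funext (trans_eq_densKernel h hmix θ)
  simp only [IsStationary, htr]
  obtain ⟨π, hπ, hπ'⟩ := M.exists_stationary θ
  exact ⟨π, ⟨hπ, hπ'⟩, fun π₂ ⟨h₁, h₂⟩ => M.stationary_unique h₂ hπ'⟩

lemma isStationary_statDist (hN : 0 < N) [Nonempty X] (h : S.Regular) (hmix : S.StrongMixing)
    (hlip : S.LipschitzGradients) (θ : Param d) : S.IsStationary N θ (S.statDist N θ) := by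
  have hex := (existsUnique_stationary hN h hmix hlip θ).exists
  rw [statDist, dif_pos hex]
  exact hex.choose_spec

lemma integrable_gradEst (hN : 0 < N) [Nonempty X] (h : S.Regular) (hmix : S.StrongMixing)
    (hlip : S.LipschitzGradients) (θ : Param d) :
    Integrable (S.gradEst N θ) (S.statDist N θ) := by
  have := (isStationary_statDist hN h hmix hlip θ).1
  obtain ⟨⟨M, -, hM⟩, hm⟩ := gradEst_props hN h hmix hlip
  exact .of_bound (hm θ).aestronglyMeasurable M (Eventually.of_forall fun z => (hM z θ θ).1)

/-- The transition kernels, jointly in the parameter and the state. -/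
lemma measurable_trans (hN : 0 < N) [Nonempty X] (h : S.Regular) (hmix : S.StrongMixing)
    (hlip : S.LipschitzGradients) :
    Measurable fun p : Param d × State N X Y E => S.trans N p.1 p.2 := by
  obtain ⟨δ, M⟩ := minorizedFamily hN h hmix hlip
  simp_rw [trans_eq_densKernel h hmix]
  exact M.measurable_densKernel

/-- Solution of the Poisson equation for the gradient estimate, and regularity of the mean field. -/
lemma exists_poisson (hN : 0 < N) [Nonempty X] (h : S.Regular) (hmix : S.StrongMixing)
    (hlip : S.LipschitzGradients) :
    (UnifLip fun (_ : State N X Y E) θ => S.meanField N θ) ∧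
    ∃ G : Param d → State N X Y E → Param d, Measurable (Function.uncurry G) ∧
      (UnifLip fun z θ => G θ z) ∧ ∀ θ z,
        ∫ z', G θ z' ∂S.trans N θ z = G θ z - S.gradEst N θ z + S.meanField N θ := by
  have := nonempty_state (N := N) h
  obtain ⟨δ, M⟩ := minorizedFamily hN h hmix hlip
  have hH := measurable_gradEst_uncurry hN h hmix hlip
  have hL := (gradEst_props hN h hmix hlip).1
  obtain ⟨B, hB0, hB⟩ := hL
  have hHB : ∀ θ z, ‖S.gradEst N θ z‖ ≤ B := fun θ z => (hB z θ θ).1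
  have htr : ∀ θ z, S.trans N θ z = densKernel (S.base N) relabel S.dens θ z :=
    trans_eq_densKernel h hmix
  have hmean : ∀ θ, S.meanField N θ = MinorizedFamily.statMean (S.base N) relabel S.dens δ
      (S.gradEst N) θ := by
    intro θ
    obtain ⟨h1, h2⟩ := isStationary_statDist hN h hmix hlip θ
    simp only [htr] at h2
    exact M.integral_stationary hH hHB h2
  refine ⟨?_, MinorizedFamily.poisson (S.base N) relabel S.dens δ (S.gradEst N),
    (M.stronglyMeasurable_poisson hH hHB).measurable, M.poisson_lip hH ⟨B, hB0, hB⟩,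
    fun θ z => ?_⟩
  · obtain ⟨K, hK⟩ := M.statMean_lip hH ⟨B, hB0, hB⟩
    refine ⟨B + |K|, by positivity, fun _ θ θ' => ⟨?_, ?_⟩⟩
    · have := (isStationary_statDist hN h hmix hlip θ).1
      have h1 := norm_integral_le_of_norm_le_const (μ := S.statDist N θ)
        (Eventually.of_forall (hHB θ))
      rw [probReal_univ, mul_one] at h1
      exact h1.trans (le_add_of_nonneg_right (abs_nonneg K))
    · beta_reduce
      rw [hmean, hmean]
      refine (hK θ θ').trans (mul_le_mul_of_nonneg_right ?_ (norm_nonneg _))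
      linarith [le_abs_self K]
  · rw [htr, hmean]
    exact M.poisson_sub_integral hH hHB θ z

lemma measurable_iter (hH : Measurable (Function.uncurry (S.gradEst N))) (γ : ℕ → ℝ) (θ₀ : Param d)
    {Ω : Type*} (m : MeasurableSpace Ω) {Z : ℕ → Ω → State N X Y E} (t : ℕ)
    (hZ : ∀ s ≤ t, Measurable (Z s)) : Measurable fun ω => S.iter N γ θ₀ (fun s => Z s ω) t := by
  induction t with
  | zero => exact measurable_const
  | succ t ih =>
    have h1 := ih fun s hs => hZ s (hs.trans t.le_succ)
    exact h1.add ((hH.comp (h1.prodMk (hZ (t + 1) le_rfl))).const_smul (γ (t + 1)))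

lemma past_le {Ω : Type*} {m : MeasurableSpace Ω} {Z : ℕ → Ω → State N X Y E}
    (hZ : ∀ t, Measurable (Z t)) (t : ℕ) : past Z t ≤ m :=
  iSup₂_le fun s _ => (hZ s).comap_le

lemma measurable_past {Ω : Type*} (Z : ℕ → Ω → State N X Y E) {s t : ℕ} (hs : s ≤ t) :
    Measurable[past Z t] (Z s) :=
  measurable_iff_comap_le.2 (le_iSup₂_of_le (f := fun s (_ : s ≤ t) =>
    (inferInstance : MeasurableSpace (State N X Y E)).comap (Z s)) s hs le_rfl)

/-- The Markov property, for functions of the current parameter and the next state. -/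
lemma IsChain.integral_eq (hN : 0 < N) [Nonempty X] (h : S.Regular) (hmix : S.StrongMixing)
    (hlip : S.LipschitzGradients) {γ : ℕ → ℝ} {θ₀ : Param d} {χ : Measure X} {u : X}
    {Ω : Type*} [MeasurableSpace Ω] {P : Measure Ω} [IsProbabilityMeasure P]
    {Z : ℕ → Ω → State N X Y E} (hZ : S.IsChain N γ θ₀ χ u P Z) (t : ℕ)
    {f : Param d × State N X Y E → ℝ} (hf : Measurable f) {B : ℝ} (hB : ∀ p, ‖f p‖ ≤ B) :
    ∫ ω, f (S.iter N γ θ₀ (fun s => Z s ω) t, Z (t + 1) ω) ∂P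
      = ∫ ω, ∫ z', f (S.iter N γ θ₀ (fun s => Z s ω) t, z')
          ∂S.trans N (S.iter N γ θ₀ (fun s => Z s ω) t) (Z t ω) ∂P := by
  have hH := (measurable_gradEst_uncurry hN h hmix hlip).measurable
  set ϑ : Ω → Param d := fun ω => S.iter N γ θ₀ (fun s => Z s ω) t with hϑ
  -- `θ_t` is a function of `Z_0, …, Z_t`, so events in `(θ_t, Z_t)` may be used as test sets for
  -- the conditional expectation.
  have hpair' : Measurable[past Z t] fun ω => (ϑ ω, Z t ω) :=
    (measurable_iter hH γ θ₀ (past Z t) t fun s hs => measurable_past Z hs).prodMk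
      (measurable_past Z le_rfl)
  have hpair : Measurable fun ω => (ϑ ω, Z t ω) := hpair'.mono (past_le hZ.measurable t) le_rfl
  let κ : Kernel (Param d × State N X Y E) (State N X Y E) :=
    ⟨fun p => S.trans N p.1 p.2, measurable_trans hN h hmix hlip⟩
  have hκ : ∀ p, κ p = S.trans N p.1 p.2 := fun p => rfl
  have hmk : IsMarkovKernel κ := by
    refine ⟨fun p => ?_⟩
    obtain ⟨δ, M⟩ := minorizedFamily hN h hmix hlip
    rw [hκ, trans_eq_densKernel h hmix]
    exact M.isProbabilityMeasure _ _
  have hprob : IsProbabilityMeasure (P.map fun ω => (ϑ ω, Z t ω)) :=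
    Measure.isProbabilityMeasure_map hpair.aemeasurable
  have hZt := hZ.measurable (t + 1)
  -- The chain property only concerns functions of `Z_{t+1}`. Testing it on rectangles identifies
  -- the joint law with `(θ_t, Z_t)`, which admits integrands that also depend on `θ_t`.
  have hlaw : P.map (fun ω => ((ϑ ω, Z t ω), Z (t + 1) ω)) = (P.map fun ω => (ϑ ω, Z t ω)) ⊗ₘ κ := by
    have : IsProbabilityMeasure (P.map (fun ω => ((ϑ ω, Z t ω), Z (t + 1) ω))) :=
      Measure.isProbabilityMeasure_map (hpair.prodMk hZt).aemeasurable
    refine Measure.ext_prod fun {A C} hA hC => ?_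
    rw [Measure.map_apply (hpair.prodMk hZt) (hA.prod hC), Measure.compProd_apply_prod hA hC,
      setLIntegral_map hA (κ.measurable_coe hC) hpair]
    have hstep := hZ.step t (C.indicator 1) (measurable_one.indicator hC)
      ⟨1, fun z => by by_cases hz : z ∈ C <;> simp [hz]⟩
    have hind : (fun ω => C.indicator (1 : State N X Y E → ℝ) (Z (t + 1) ω))
        = (Z (t + 1) ⁻¹' C).indicator 1 := by
      funext ω
      rfl
    have hint : Integrable (fun ω => C.indicator (1 : State N X Y E → ℝ) (Z (t + 1) ω)) P := by
      rw [hind]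
      exact (integrable_const (1 : ℝ)).indicator (hZt hC)
    have h1 := setIntegral_condExp (past_le hZ.measurable t) hint (hpair' hA)
    have hA' := hpair hA
    rw [setIntegral_congr_ae hA' (hstep.mono fun ω hω _ => hω), hind,
      integral_indicator_one (hZt hC), measureReal_restrict_apply (hZt hC)] at h1
    simp_rw [integral_indicator_one hC] at h1
    have h2 : ∫ ω in (fun ω => (ϑ ω, Z t ω)) ⁻¹' A, (S.trans N (ϑ ω) (Z t ω)).real C ∂P
        = (∫⁻ ω in (fun ω => (ϑ ω, Z t ω)) ⁻¹' A, κ (ϑ ω, Z t ω) C ∂P).toReal := by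
      refine integral_toReal ((κ.measurable_coe hC).comp hpair).aemeasurable
        (Eventually.of_forall fun ω => measure_lt_top (κ (ϑ ω, Z t ω)) C)
    rw [h2, measureReal_def, ENNReal.toReal_eq_toReal_iff' _ (measure_ne_top _ _)] at h1
    · rw [h1, Set.inter_comm]
      rfl
    · refine ((lintegral_mono fun ω => prob_le_one).trans_lt ?_).ne
      rw [lintegral_one]
      exact measure_lt_top _ _
  have hf' : Measurable fun q : (Param d × State N X Y E) × State N X Y E => f (q.1.1, q.2) :=
    hf.comp (by fun_prop)
  have h1 := Measure.integral_compProd (μ := P.map fun ω => (ϑ ω, Z t ω)) (κ := κ)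
    (f := fun q => f (q.1.1, q.2)) (.of_bound hf'.aestronglyMeasurable B
      (Eventually.of_forall fun q => hB _))
  rw [← hlaw, integral_map (hpair.prodMk hZt).aemeasurable hf'.aestronglyMeasurable,
    integral_map hpair.aemeasurable] at h1
  · exact h1
  · exact (hf'.stronglyMeasurable.integral_kernel_prod_right').aestronglyMeasurable

end Model

/-! ### The random index and the final averaged bound. -/

/-- Averaging over an independent categorical index. -/
lemma integral_of_isCat {γ : ℕ → ℝ} {t : ℕ} {Ω Ω' : Type*} [MeasurableSpace Ω]
    [MeasurableSpace Ω'] {P : Measure Ω} [IsProbabilityMeasure P] {τ : Ω → ℕ} {W : Ω → Ω'}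
    (hτ : IsCat γ t P τ) (hW : Measurable W) (hind : IndepFun τ W P) {g : ℕ → Ω' → ℝ}
    (hg : ∀ s, Measurable (g s)) {B : ℝ} (hB : ∀ s w, ‖g s w‖ ≤ B) :
    Integrable (fun ω => g (τ ω) (W ω)) P ∧ ∫ ω, g (τ ω) (W ω) ∂P
      = (∑ s ∈ Finset.range (t + 1), γ (s + 1) * ∫ ω, g s (W ω) ∂P) /
        ∑ k ∈ Finset.range (t + 1), γ (k + 1) := by
  obtain ⟨hτm, hτt, hτp⟩ := hτ
  have hm : Measurable fun ω => g (τ ω) (W ω) :=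
    (measurable_from_prod_countable_right (f := fun p : ℕ × Ω' => g p.1 p.2) hg).comp
      (hτm.prodMk hW)
  refine ⟨.of_bound hm.aestronglyMeasurable B (Eventually.of_forall fun ω => hB _ _), ?_⟩
  -- Splitting by the value of `τ` leaves summands whose expectations factor by independence.
  have hsplit : (fun ω => g (τ ω) (W ω)) =ᵐ[P] fun ω => ∑ s ∈ Finset.range (t + 1),
      ({s} : Set ℕ).indicator (1 : ℕ → ℝ) (τ ω) * g s (W ω) := by
    filter_upwards [hτt] with ω hω
    rw [Finset.sum_eq_single (τ ω)]
    · simp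
    · intro s _ hs
      rw [Set.indicator_of_notMem (fun h => hs (Set.mem_singleton_iff.1 h).symm), zero_mul]
    · intro h
      exact absurd (Finset.mem_range.2 (Nat.lt_succ_of_le hω)) h
  have hgi : ∀ s, Integrable (fun ω => g s (W ω)) P := fun s =>
    .of_bound ((hg s).comp hW).aestronglyMeasurable B (Eventually.of_forall fun ω => hB _ _)
  have hi1 : ∀ s, Measurable (({s} : Set ℕ).indicator (1 : ℕ → ℝ)) := fun s =>
    measurable_from_top
  rw [integral_congr_ae hsplit, integral_finsetSum, Finset.sum_div]
  · refine Finset.sum_congr rfl fun s hs => ?_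
    have h1 := (hind.comp (hi1 s) (hg s)).integral_fun_mul_eq_mul_integral
      ((hi1 s).comp hτm).aestronglyMeasurable ((hg s).comp hW).aestronglyMeasurable
    have h2 : ∫ ω, ({s} : Set ℕ).indicator (1 : ℕ → ℝ) (τ ω) ∂P = P.real (τ ⁻¹' {s}) := by
      rw [← integral_indicator_one (hτm (measurableSet_singleton s))]
      rfl
    rw [hτp s (Nat.lt_succ_iff.1 (Finset.mem_range.1 hs))] at h2
    refine Eq.trans h1 ?_
    simp only [Function.comp_apply]
    rw [h2]
    ring
  · intro s _
    refine (hgi s).bdd_mul (c := 1) ((hi1 s).comp hτm).aestronglyMeasurable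
      (Eventually.of_forall fun ω => ?_)
    by_cases h : τ ω ∈ ({s} : Set ℕ) <;> simp only [Set.indicator, h] <;> simp

namespace Model

variable {d : ℕ} {X Y E : Type*} [MeasurableSpace X] [MeasurableSpace Y] [MeasurableSpace E]
  {N : ℕ} {S : Model d X Y E}

/-- The weighted mean squared norm of the mean field along the iterates, with a constant that does
not depend on the chain. -/
lemma exists_average_bound (hN : 0 < N) [Nonempty X] (h : S.Regular) (hmix : S.StrongMixing)
    (hlip : S.LipschitzGradients) {V : Param d → ℝ} (hVbdd : ∃ B, ∀ θ, |V θ| ≤ B)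
    (hV : ∀ θ, HasGradientAt V (S.meanField N θ) θ) {c : ℝ} (hc : 0 < c) :
    ∃ C : ℝ, ∀ (θ₀ : Param d) (χ : Measure X) (u : X) (Ω : Type*) (_ : MeasurableSpace Ω)
      (P : Measure Ω) (_ : IsProbabilityMeasure P) (Z : ℕ → Ω → State N X Y E)
      (_ : S.IsChain N (stepSize c) θ₀ χ u P Z) (t : ℕ) (_ : 2 ≤ t),
      (∑ s ∈ Finset.range (t + 1), stepSize c (s + 1) *
          ∫ ω, ‖S.meanField N (S.iter N (stepSize c) θ₀ (fun s => Z s ω) s)‖ ^ 2 ∂P) /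
        ∑ k ∈ Finset.range (t + 1), stepSize c (k + 1) ≤ C * (Real.log t / Real.sqrt t) := by
  obtain ⟨hh, G, hGm, hG, hpoi⟩ := exists_poisson hN h hmix hlip
  obtain ⟨hHL, hHθ⟩ := gradEst_props hN h hmix hlip
  have hH := (measurable_gradEst_uncurry hN h hmix hlip).measurable
  have := nonempty_state (N := N) h
  have z₀ : State N X Y E := Classical.arbitrary _
  have hhm : Measurable (S.meanField N) := (hh.continuous z₀).measurable
  have hA := hh.inner hG
  have hΨ := hh.inner ((hG.sub hHL).add hh)
  have hVm : Measurable V := by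
    refine Continuous.measurable ?_
    exact continuous_iff_continuousAt.2 fun θ => (hV θ).hasFDerivAt.continuousAt
  obtain ⟨BV, hBV⟩ := hVbdd
  obtain ⟨L, hL0, hL⟩ := hh
  obtain ⟨B, hB0, hB⟩ := hHL
  obtain ⟨K, hK0, hK⟩ := hΨ
  obtain ⟨K', hK'0, hK'⟩ := hA
  -- All bounds are fixed before the chain is introduced, so the constant is uniform over starting
  -- points and initial laws. `K * B` is the cost of moving the parameter in `Ψ`, and `L * B ^ 2` is
  -- the quadratic error for `V`.
  refine ⟨(4 * BV + 4 * c * K + 4 * ((K * B + L * B ^ 2) * c ^ 2)) / c, ?_⟩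
  intro θ₀ χ u Ω _ P _ Z hZ t ht
  set γ := stepSize c with hγ
  have hγ0 : ∀ s, 0 ≤ γ s := stepSize_nonneg hc
  let ϑ : ℕ → Ω → Param d := fun s ω => S.iter N γ θ₀ (fun s => Z s ω) s
  have hϑ : ∀ s, Measurable (ϑ s) := fun s =>
    measurable_iter hH γ θ₀ _ s fun r _ => hZ.measurable r
  have hsucc : ∀ s ω, ϑ (s + 1) ω = ϑ s ω + γ (s + 1) • S.gradEst N (ϑ s ω) (Z (s + 1) ω) :=
    fun s ω => rfl
  -- By the Poisson equation `Ψ` is the inner product of `h(θ)` with `T_θ G_θ`, that is, the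
  -- one-step conditional mean of `A`.
  let Ψ : Param d × State N X Y E → ℝ := fun p =>
    inner ℝ (S.meanField N p.1) (G p.1 p.2 - S.gradEst N p.1 p.2 + S.meanField N p.1)
  let A : Param d × State N X Y E → ℝ := fun p => inner ℝ (S.meanField N p.1) (G p.1 p.2)
  have hΨm : Measurable Ψ := (hhm.comp measurable_fst).inner
    ((hGm.sub hH).add (hhm.comp measurable_fst))
  have hAm : Measurable A := (hhm.comp measurable_fst).inner hGm
  have hi : ∀ (f : Param d × State N X Y E → ℝ) (_ : Measurable f) (M : ℝ) (_ : ∀ p, ‖f p‖ ≤ M)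
      (s r : ℕ), Integrable (fun ω => f (ϑ s ω, Z r ω)) P := fun f hf M hM s r =>
    .of_bound (hf.comp ((hϑ s).prodMk (hZ.measurable r))).aestronglyMeasurable M
      (Eventually.of_forall fun ω => hM _)
  have hΨi := hi Ψ hΨm K fun p => (hK p.2 p.1 p.1).1
  have hAi := hi A hAm K' fun p => (hK' p.2 p.1 p.1).1
  have hVi : ∀ s, Integrable (fun ω => V (ϑ s ω)) P := fun s =>
    hi (fun p => V p.1) (hVm.comp measurable_fst) BV (fun p => hBV p.1) s 0
  have hsqi : ∀ s, Integrable (fun ω => ‖S.meanField N (ϑ s ω)‖ ^ 2) P := fun s =>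
    hi (fun p => ‖S.meanField N p.1‖ ^ 2) ((hhm.comp measurable_fst).norm.pow_const 2) (L ^ 2)
      (fun p => by
        rw [norm_pow, norm_norm]
        exact pow_le_pow_left₀ (norm_nonneg _) (hL z₀ p.1 p.1).1 2) s 0
  have hGi : ∀ θ z, Integrable (G θ) (S.trans N θ z) := by
    intro θ z
    obtain ⟨δ, M⟩ := minorizedFamily hN h hmix hlip
    have := M.isProbabilityMeasure θ z
    rw [← trans_eq_densKernel h hmix] at this
    obtain ⟨KG, -, hKG⟩ := hG
    exact .of_bound (hGm.comp measurable_prodMk_left).aestronglyMeasurable KG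
      (Eventually.of_forall fun z => (hKG z θ θ).1)
  have hmarkov : ∀ s, ∫ ω, A (ϑ s ω, Z (s + 1) ω) ∂P = ∫ ω, Ψ (ϑ s ω, Z s ω) ∂P := by
    intro s
    refine (hZ.integral_eq hN h hmix hlip s hAm fun p => (hK' p.2 p.1 p.1).1).trans ?_
    refine integral_congr_ae (Eventually.of_forall fun ω => ?_)
    change ∫ z', inner ℝ (S.meanField N (ϑ s ω)) (G (ϑ s ω) z')
      ∂S.trans N (ϑ s ω) (Z s ω) = Ψ (ϑ s ω, Z s ω)
    rw [integral_inner (hGi _ _), hpoi]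
  have habs : ∀ (f : Ω → ℝ) (M : ℝ), (∀ ω, |f ω| ≤ M) → |∫ ω, f ω ∂P| ≤ M := by
    intro f M hM
    have := norm_integral_le_of_norm_le_const (μ := P) (f := f) (Eventually.of_forall hM)
    rwa [probReal_univ, mul_one] at this
  refine average_le (v := fun s => ∫ ω, V (ϑ s ω) ∂P) (b := fun s => ∫ ω, Ψ (ϑ s ω, Z s ω) ∂P)
    hc (by positivity) (fun s => habs _ _ fun ω => hBV _)
    (fun s => habs _ _ fun ω => (hK (Z s ω) (ϑ s ω) (ϑ s ω)).1) (fun s => ?_) ht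
  -- Pointwise drift. `Ψ` is evaluated at the new parameter so that in expectation, by `hmarkov`,
  -- the bracket becomes an increment of one and the same sequence.
  have hpt : ∀ ω, γ (s + 1) * ‖S.meanField N (ϑ s ω)‖ ^ 2 ≤ V (ϑ (s + 1) ω) - V (ϑ s ω)
      + γ (s + 1) * (Ψ (ϑ (s + 1) ω, Z (s + 1) ω) - A (ϑ s ω, Z (s + 1) ω))
      + (K * B + L * B ^ 2) * γ (s + 1) ^ 2 := by
    intro ω
    set θ := ϑ s ω
    set z := Z (s + 1) ω
    have h1 := le_of_gradient_lipschitz hV hL0 (fun θ θ' => (hL z₀ θ θ').2) θ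
      (γ (s + 1) • S.gradEst N θ z)
    rw [← hsucc, inner_smul_right] at h1
    have hu : ‖γ (s + 1) • S.gradEst N θ z‖ ≤ γ (s + 1) * B := by
      rw [norm_smul, Real.norm_of_nonneg (hγ0 _)]
      exact mul_le_mul_of_nonneg_left (hB z θ θ).1 (hγ0 _)
    have h2 : L * ‖γ (s + 1) • S.gradEst N θ z‖ ^ 2 ≤ L * (γ (s + 1) * B) ^ 2 :=
      mul_le_mul_of_nonneg_left (pow_le_pow_left₀ (norm_nonneg _) hu 2) hL0
    have h3 : |Ψ (ϑ (s + 1) ω, z) - Ψ (θ, z)| ≤ K * (γ (s + 1) * B) := by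
      refine ((hK z (ϑ (s + 1) ω) θ).2).trans (mul_le_mul_of_nonneg_left ?_ hK0)
      rw [hsucc, add_sub_cancel_left]
      exact hu
    have h4 : Ψ (θ, z) = A (θ, z) - inner ℝ (S.meanField N θ) (S.gradEst N θ z)
        + ‖S.meanField N θ‖ ^ 2 := by
      simp only [Ψ, A]
      rw [inner_add_right, inner_sub_right, real_inner_self_eq_norm_sq]
    have h5 : γ (s + 1) * (Ψ (θ, z) - K * (γ (s + 1) * B)) ≤ γ (s + 1) * Ψ (ϑ (s + 1) ω, z) :=
      mul_le_mul_of_nonneg_left (by linarith [(abs_le.1 h3).1]) (hγ0 _)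
    rw [h4] at h5
    linarith
  have hd1 : Integrable (fun ω => V (ϑ (s + 1) ω) - V (ϑ s ω)) P := (hVi _).sub (hVi _)
  have hd2 : Integrable (fun ω => Ψ (ϑ (s + 1) ω, Z (s + 1) ω) - A (ϑ s ω, Z (s + 1) ω)) P :=
    (hΨi _ _).sub (hAi _ _)
  have hd3 : Integrable (fun ω => V (ϑ (s + 1) ω) - V (ϑ s ω)
      + γ (s + 1) * (Ψ (ϑ (s + 1) ω, Z (s + 1) ω) - A (ϑ s ω, Z (s + 1) ω))) P :=
    hd1.add (hd2.const_mul _)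
  have hint := integral_mono ((hsqi s).const_mul (γ (s + 1))) (hd3.add (integrable_const
    ((K * B + L * B ^ 2) * γ (s + 1) ^ 2))) hpt
  simp only [Pi.add_apply] at hint
  rw [integral_const_mul, integral_add hd3 (integrable_const _), integral_add hd1
    (hd2.const_mul _), integral_const_mul, integral_sub (hVi _) (hVi _),
    integral_sub (hΨi _ _) (hAi _ _), hmarkov, integral_const, probReal_univ, one_smul] at hint
  exact hint

end Model

end OVSMC

end

theorem corollary4p8 {d N : ℕ} (hN : 0 < N)
    {X Y E : Type*} [MeasurableSpace X] [MeasurableSpace Y] [MeasurableSpace E] [Nonempty X]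
    (S : OVSMC.Model d X Y E) (hreg : S.Regular) (hmix : S.StrongMixing)
    (hlip : S.LipschitzGradients)
    (V : OVSMC.Param d → ℝ) (hVbdd : ∃ B, ∀ θ, |V θ| ≤ B)
    (hV : ∀ θ, HasGradientAt V (S.meanField N θ) θ)
    (c : ℝ) (hc : 0 < c) :
    -- the mean field is well defined
    (∀ θ, (∃! π, S.IsStationary N θ π) ∧ Integrable (S.gradEst N θ) (S.statDist N θ)) ∧
    -- the convergence rate
    ∃ C : ℝ, ∀ (θ₀ : OVSMC.Param d) (χ : Measure X) (_ : IsProbabilityMeasure χ) (u : X)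
      (Ω : Type*) (_ : MeasurableSpace Ω) (P : Measure Ω) (_ : IsProbabilityMeasure P)
      (Z : ℕ → Ω → OVSMC.State N X Y E)
      (_ : S.IsChain N (OVSMC.stepSize c) θ₀ χ u P Z)
      (t : ℕ) (_ : 2 ≤ t) (τ : Ω → ℕ) (_ : OVSMC.IsCat (OVSMC.stepSize c) t P τ)
      (_ : IndepFun τ (fun ω s => Z s ω) P),
      Integrable (fun ω => ‖S.meanField N
        (S.iter N (OVSMC.stepSize c) θ₀ (fun s => Z s ω) (τ ω))‖ ^ 2) P ∧
      ∫ ω, ‖S.meanField N (S.iter N (OVSMC.stepSize c) θ₀ (fun s => Z s ω) (τ ω))‖ ^ 2 ∂P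
        ≤ C * (Real.log t / Real.sqrt t) := by
  refine ⟨fun θ => ⟨OVSMC.Model.existsUnique_stationary hN hreg hmix hlip θ,
    OVSMC.Model.integrable_gradEst hN hreg hmix hlip θ⟩, ?_⟩
  obtain ⟨C, hC⟩ := OVSMC.Model.exists_average_bound hN hreg hmix hlip hVbdd hV hc
  have hH := (OVSMC.Model.measurable_gradEst_uncurry hN hreg hmix hlip).measurable
  have := OVSMC.Model.nonempty_state (N := N) hreg
  have hh := (OVSMC.Model.exists_poisson hN hreg hmix hlip).1
  have hhm : Measurable (S.meanField N) := (hh.continuous (Classical.arbitrary _)).measurable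
  obtain ⟨L, -, hL⟩ := hh
  refine ⟨C, fun θ₀ χ _ u Ω _ P _ Z hZ t ht τ hτ hind => ?_⟩
  -- The iterates are viewed as functions on trajectory space, since `τ` is independent of the
  -- trajectory as a whole.
  have hiter : ∀ s, Measurable fun w : ℕ → OVSMC.State N X Y E =>
      S.iter N (OVSMC.stepSize c) θ₀ w s := fun s =>
    OVSMC.Model.measurable_iter hH (OVSMC.stepSize c) θ₀ inferInstance
      (Z := fun r (w : ℕ → OVSMC.State N X Y E) => w r) s fun r _ => measurable_pi_apply r
  have hsq : ∀ s, Measurable fun w : ℕ → OVSMC.State N X Y E =>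
      ‖S.meanField N (S.iter N (OVSMC.stepSize c) θ₀ w s)‖ ^ 2 := fun s =>
    (hhm.comp (hiter s)).norm.pow_const 2
  have hbd : ∀ s (w : ℕ → OVSMC.State N X Y E),
      ‖‖S.meanField N (S.iter N (OVSMC.stepSize c) θ₀ w s)‖ ^ 2‖ ≤ L ^ 2 := fun s w => by
    rw [norm_pow, norm_norm]
    exact pow_le_pow_left₀ (norm_nonneg _)
      (hL (Classical.arbitrary _) (S.iter N (OVSMC.stepSize c) θ₀ w s) 0).1 2
  have hfin := OVSMC.integral_of_isCat hτ (measurable_pi_iff.2 hZ.measurable) hind hsq hbd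
  exact ⟨hfin.1, hfin.2.trans_le (hC θ₀ χ u Ω _ P inferInstance Z hZ t ht)⟩
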